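/- Let $A(z)$ denote the alternating Kurepa function, i.e. the function given for $\operatorname{Re} z>0$ by $$A(z)=\int_0^\infty e^{-t}\,\frac{t^{z+1}-(-1)^z t}{t+1}\,dt,\qquad (-1)^z=e^{i\pi z},$$ and continued to $\operatorname{Re} z\le 0$ by means of $A(z)=\Gamma(z+2)-A(z+1)$. Let $$A_1(z)=\sum_{n=0}^{\infty}(-1)^n\,\Gamma(z+1-n)\qquad (z\in\mathbb C\setminus\mathbb Z).$$ Both functions are meromorphic on $\mathbb C$, and neither of them satisfies any algebraic differential equation over the field $\mathbb C(z)$ of rational functions. That is, for every domain (nonempty connected open set) $D\subseteq\mathbb C$, for $g=A$ and for $g=A_1$, there are no integer $n\ge 0$ and no nonzero polynomial $P\in\mathbb C(z)[X_0,\dots,X_n]$ such that $P\bigl(g,g',\dots,g^{(n)}\bigr)=0$ as meromorphic functions on $D$. -/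

import Mathlib

noncomputable section

namespace AlternatingKurepa

/-- The integral `∫₀^∞ e^{-t} (t^{z+1} - (-1)^z t) / (t + 1) dt`, considered for `Re z > 0`.
Complex powers are principal, so `(-1)^z = exp (i π z)`. -/
def kurepaIntegral (z : ℂ) : ℂ :=
  ∫ t in Set.Ioi (0 : ℝ),
    (Real.exp (-t) : ℂ) * (((t : ℂ) ^ (z + 1) - (-1 : ℂ) ^ z * (t : ℂ)) / ((t : ℂ) + 1))

/-- The least natural number `n` with `Re (z + n) > 0`. -/
def shiftSteps (z : ℂ) : ℕ := (⌊-z.re⌋ + 1).toNat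

/-- The alternating Kurepa function `A(z)`: the integral for `Re z > 0` (there the number of
steps is `0`), continued to `Re z ≤ 0` by iterating `A(z) = Γ(z + 2) - A(z + 1)`, which gives
`A(z) = (-1)^n A(z + n) + ∑_{k < n} (-1)^k Γ(z + k + 2)`.
The values at the poles `z = -2, -3, …` are irrelevant placeholders. -/
def kurepaA (z : ℂ) : ℂ :=
  (-1 : ℂ) ^ shiftSteps z * kurepaIntegral (z + (shiftSteps z : ℂ)) +
    ∑ k ∈ Finset.range (shiftSteps z), (-1 : ℂ) ^ k * Complex.Gamma (z + (k : ℂ) + 2)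

/-- The function `A₁(z) = ∑_{n ≥ 0} (-1)^n Γ(z + 1 - n)` for `z` not an integer.
The values at the integers, which are poles, are irrelevant placeholders. -/
def kurepaA1 (z : ℂ) : ℂ :=
  ∑' n : ℕ, (-1 : ℂ) ^ n * Complex.Gamma (z + 1 - (n : ℂ))

/-- The value at `z` of `P(f, f', f'', …)`, for a polynomial `P` in the variables
`X₀, X₁, X₂, …` (finitely many of which occur) with coefficients in `ℂ(z)`;
the variable `Xᵢ` is replaced by the `i`-th derivative of `f`. -/
def diffPolyEval (P : MvPolynomial ℕ (RatFunc ℂ)) (f : ℂ → ℂ) (z : ℂ) : ℂ :=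
  ∑ m ∈ P.support,
    (P.coeff m).eval (RingHom.id ℂ) z * ∏ i ∈ m.support, iteratedDeriv i f z ^ m i

/-- `f` satisfies on `D` some algebraic differential equation over `ℂ(z)`: there is a nonzero
polynomial `P` over `ℂ(z)` such that `P(f, f', f'', …) = 0` as meromorphic functions on `D`,
that is, at all points of `D` outside a set that is discrete and relatively closed in `D`
(it takes up poles of `f` and of the coefficients). -/
def SatisfiesADE (D : Set ℂ) (f : ℂ → ℂ) : Prop :=
  ∃ P : MvPolynomial ℕ (RatFunc ℂ), P ≠ 0 ∧
    ∀ᶠ z in Filter.codiscreteWithin D, diffPolyEval P f z = 0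

end AlternatingKurepa

end

/-! ### Differentially algebraic elements of a domain with a derivation. -/

namespace Algebra

open Polynomial

variable {R A : Type*} [CommRing R] [CommRing A] [Algebra R A]

/-! Both functions are holomorphic off the integers and satisfy `f(z) + f(z+1) = Γ(z+2)`; nothing
else about them is used. The claim thus reduces to Hölder's theorem on the Gamma function.

Since `ℂ ∖ ℤ` is connected, the identity theorem carries a differential equation from any domain to
the upper half plane, which is stable under `z ↦ z + 1` and free of poles
(`SatisfiesADE.isDifferentiallyAlgebraic`). There `f` becomes an element of a differential domain
with a shift. If `f` is differentially algebraic, then so are `f(z+1)`, the sum `G = Γ(z+2)` and its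
logarithmic derivative `ψ` (`IsDifferentiallyAlgebraic.logDeriv_add`).

But `ψ(z+1) = ψ(z) + 1/(z+2)`, so the shift translates each derivative of `ψ` by the rational
function `rᵢ = (-1)^i i!/(z+2)^(i+1)`. Among the algebraic relations between these derivatives, a
monic one of minimal degree is fixed by the translation. Partial derivatives of a fixed polynomial
are again fixed, so there is one of degree one, which yields `∑ cᵢ rᵢ = b(z) - b(z+1)` with
1-periodic, hence constant, `cᵢ` not all zero (`MvPolynomial.exists_linear_relation_of_translates`).
The left side has exactly one pole, which `b(z) - b(z+1)` cannot have for rational `b`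
(`RatFunc.sum_principal_parts_ne_sub_shift`). -/

theorem derivation_isAlgebraic_of_mem_adjoin [IsDomain A] (D : Derivation ℤ A A) {S : Set A}
    (hR : ∀ r : R, ∃ r' : R, D (algebraMap R A r) = algebraMap R A r')
    (hS : ∀ s ∈ S, IsAlgebraic (adjoin R S) (D s)) {x : A} (hx : x ∈ adjoin R S) :
    IsAlgebraic (adjoin R S) (D x) := by
  have key : ∀ y ∈ adjoin R S, IsAlgebraic (adjoin R S) y := fun y hy =>
    isAlgebraic_algebraMap (⟨y, hy⟩ : adjoin R S)
  induction hx using adjoin_induction with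
  | mem x hx => exact hS x hx
  | algebraMap r =>
    obtain ⟨r', hr'⟩ := hR r
    rw [hr']
    exact key _ (Subalgebra.algebraMap_mem _ _)
  | add x y _ _ hx hy => rw [map_add]; exact hx.add hy
  | mul x y hx' hy' hx hy =>
    rw [Derivation.leibniz, smul_eq_mul, smul_eq_mul]
    exact ((key x hx').mul hy).add ((key y hy').mul hx)

/-- Chain rule: `y` is the value at `x` of `p` with differentiated coefficients. Only its
algebraicity is recorded, because `D` need not map `B` into itself. -/
theorem derivation_aeval_eq (D : Derivation ℤ A A) {B : Type*} [CommRing B] [IsDomain B]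
    [Algebra B A] (hB : ∀ b : B, IsAlgebraic B (D (algebraMap B A b))) {x : A}
    (hx : IsAlgebraic B x) (p : B[X]) :
    ∃ y, IsAlgebraic B y ∧ D (aeval x p) = y + aeval x (derivative p) * D x := by
  induction p using Polynomial.induction_on' with
  | add p q hp hq =>
    obtain ⟨y, hy, h⟩ := hp
    obtain ⟨z, hz, h'⟩ := hq
    refine ⟨y + z, hy.add hz, ?_⟩
    simp only [map_add, h, h']
    ring
  | monomial n b =>
    refine ⟨D (algebraMap B A b) * x ^ n, (hB b).mul (hx.pow n), ?_⟩
    simp only [aeval_monomial, derivative_monomial, Derivation.leibniz, Derivation.leibniz_pow,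
      smul_eq_mul, nsmul_eq_mul, map_mul, map_natCast]
    ring

/-- The relative algebraic closure of an algebra generated by `S` is stable under a derivation
as soon as it contains the derivatives of the elements of `S`. -/
theorem derivation_isAlgebraic [IsDomain A] [CharZero A] (D : Derivation ℤ A A) {S : Set A}
    (hR : ∀ r : R, ∃ r' : R, D (algebraMap R A r) = algebraMap R A r')
    (hS : ∀ s ∈ S, IsAlgebraic (adjoin R S) (D s)) {x : A} (hx : IsAlgebraic (adjoin R S) x) :
    IsAlgebraic (adjoin R S) (D x) := by
  classical
  have hB : ∀ b : adjoin R S, IsAlgebraic (adjoin R S) (D (algebraMap (adjoin R S) A b)) :=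
    fun b => derivation_isAlgebraic_of_mem_adjoin D hR hS b.2
  have hex : ∃ n, ∃ p : (adjoin R S)[X], p ≠ 0 ∧ aeval x p = 0 ∧ p.natDegree = n := by
    obtain ⟨p, h0, h1⟩ := hx
    exact ⟨_, p, h0, h1, rfl⟩
  obtain ⟨p, hp0, hpx, hpn⟩ := Nat.find_spec hex
  have hinj : Function.Injective (algebraMap (adjoin R S) A) := Subtype.val_injective
  have hdeg : p.natDegree ≠ 0 := by
    intro h
    rw [eq_C_of_natDegree_eq_zero h] at hpx hp0
    rw [aeval_C] at hpx
    exact hp0 (by rw [(injective_iff_map_eq_zero _).1 hinj _ hpx, C_0])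
  -- Minimality of the degree of `p`, together with characteristic zero.
  have hd : aeval x (derivative p) ≠ 0 := by
    intro h
    refine Nat.find_min hex (m := (derivative p).natDegree) ?_ ⟨_, ?_, h, rfl⟩
    · rw [← hpn]
      exact natDegree_derivative_lt hdeg
    · intro h0
      have : CharZero (adjoin R S) := by
        refine ⟨fun m n hmn => ?_⟩
        have := congrArg (algebraMap (adjoin R S) A) hmn
        simpa using this
      exact hdeg (derivative_eq_zero.1 h0)
  obtain ⟨y, hy, h⟩ := derivation_aeval_eq D hB hx p
  rw [hpx, map_zero] at h
  refine IsAlgebraic.of_mul (mem_nonZeroDivisors_of_ne_zero hd) ?_ ?_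
  · have := (aeval (⟨x, hx⟩ : Subalgebra.algebraicClosure (adjoin R S) A) (derivative p)).2
    rwa [← Subalgebra.aeval_coe] at this
  · rw [show aeval x (derivative p) * D x = -y by linear_combination -h]
    exact hy.neg

/-- `x` is differentially algebraic over `R` for the derivation `D`. -/
def IsDifferentiallyAlgebraic (R : Type*) {A : Type*} [CommRing R] [CommRing A] [Algebra R A]
    (D : Derivation ℤ A A) (x : A) : Prop :=
  ¬ AlgebraicIndependent R (fun i : ℕ => D^[i] x)

/-- Some `D^[n] x` is algebraic over its predecessors, and these serve as `S`. In this form two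
elements can be treated together by taking the union of their sets. -/
theorem IsDifferentiallyAlgebraic.exists_finite [IsDomain A] [FaithfulSMul R A]
    {D : Derivation ℤ A A} {x : A}
    (hx : IsDifferentiallyAlgebraic R D x) :
    ∃ S : Set A, S.Finite ∧ IsAlgebraic (adjoin R S) x ∧
      ∀ s ∈ S, IsAlgebraic (adjoin R S) (D s) := by
  have h : ∃ n, IsAlgebraic (adjoin R ((fun i => D^[i] x) '' Set.Iio n)) (D^[n] x) := by
    by_contra! hn
    apply hx
    have hI : ∀ n, AlgebraicIndepOn R (fun i => D^[i] x) (Set.Iio n) := by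
      intro n
      induction n with
      | zero =>
        have : IsEmpty (Set.Iio 0) := by simp
        exact algebraicIndependent_empty_type_iff.2 (FaithfulSMul.algebraMap_injective R A)
      | succ n ih =>
        have := ih.insert (hn n)
        rwa [← Order.Iio_succ_eq_insert] at this
    refine algebraicIndependent_of_finite_type fun t ht => ?_
    obtain ⟨m, hm⟩ := ht.bddAbove
    exact (hI (m + 1)).mono fun i hi => Nat.lt_succ_of_le (hm hi)
  obtain ⟨n, hn⟩ := h
  have hmem : ∀ i < n + 1,
      IsAlgebraic (adjoin R ((fun i => D^[i] x) '' Set.Iio n)) (D^[i] x) := by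
    intro i hi
    rcases Nat.lt_succ_iff_lt_or_eq.1 hi with h | rfl
    · exact isAlgebraic_algebraMap 
        (⟨_, subset_adjoin ⟨i, h, rfl⟩⟩ : adjoin R ((fun i => D^[i] x) '' Set.Iio n))
    · exact hn
  refine ⟨_, (Set.finite_Iio n).image _, hmem 0 n.succ_pos, ?_⟩
  rintro _ ⟨i, hi, rfl⟩
  simpa only [Function.iterate_succ_apply'] using hmem (i + 1) (Nat.succ_lt_succ hi)

theorem isAlgebraic_adjoin_mono [IsDomain A] {S S' : Set A} (h : S ⊆ S') {x : A}
    (hx : IsAlgebraic (adjoin R S) x) : IsAlgebraic (adjoin R S') x :=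
  hx.adjoin_of_forall_isAlgebraic fun _ hs => (hs.2 (h hs.1)).elim

/-- All `D^[i] x` lie in the relative algebraic closure of the algebra generated by `S`. An infinite
independent family cannot, since the rank of this closure in the algebraic independence matroid is
at most the size of `S`. -/
theorem isDifferentiallyAlgebraic_of_finite [IsDomain R] [IsDomain A] [CharZero A]
    [FaithfulSMul R A] {D : Derivation ℤ A A} {S : Set A} (hf : S.Finite)
    (hR : ∀ r : R, ∃ r' : R, D (algebraMap R A r) = algebraMap R A r')
    (hS : ∀ s ∈ S, IsAlgebraic (adjoin R S) (D s)) {x : A} (hx : IsAlgebraic (adjoin R S) x) :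
    IsDifferentiallyAlgebraic R D x := by
  intro hind
  have hL : ∀ i, IsAlgebraic (adjoin R S) (D^[i] x) := by
    intro i
    induction i with
    | zero => exact hx
    | succ i ih =>
      rw [Function.iterate_succ_apply']
      exact derivation_isAlgebraic D hR hS ih
  have h1 : (AlgebraicIndependent.matroid R A).Indep (Set.range fun i : ℕ => D^[i] x) :=
    AlgebraicIndependent.matroid_indep_iff.2 (AlgebraicIndependent.coe_range hind)
  have h2 : Set.range (fun i : ℕ => D^[i] x) ⊆ (AlgebraicIndependent.matroid R A).closure S := by
    rintro _ ⟨i, rfl⟩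
    rw [AlgebraicIndependent.matroid_closure_eq]
    exact hL i
  have h3 := (AlgebraicIndependent.matroid R A).eRk_mono h2
  rw [h1.eRk_eq_encard, Matroid.eRk_closure_eq,
    (Set.infinite_range_of_injective hind.injective).encard_eq] at h3
  exact absurd (top_le_iff.1 (h3.trans (Matroid.eRk_le_encard _ _))) hf.encard_lt_top.ne

/-- The logarithmic derivative of a sum of two differentially algebraic elements is
differentially algebraic. -/
theorem IsDifferentiallyAlgebraic.logDeriv_add [IsDomain R] [IsDomain A] [CharZero A]
    [FaithfulSMul R A] {D : Derivation ℤ A A} {x y u : A}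
    (hR : ∀ r : R, ∃ r' : R, D (algebraMap R A r) = algebraMap R A r')
    (hx : IsDifferentiallyAlgebraic R D x) (hy : IsDifferentiallyAlgebraic R D y)
    (hu : (x + y) * u = 1) : IsDifferentiallyAlgebraic R D (D (x + y) * u) := by
  obtain ⟨S, hSf, hSx, hS⟩ := hx.exists_finite
  obtain ⟨S', hSf', hSy, hS'⟩ := hy.exists_finite
  have hl : S ⊆ S ∪ S' := Set.subset_union_left
  have hr : S' ⊆ S ∪ S' := Set.subset_union_right
  have hD : ∀ s ∈ S ∪ S', IsAlgebraic (adjoin R (S ∪ S')) (D s) := by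
    rintro s (hs | hs)
    · exact isAlgebraic_adjoin_mono hl (hS s hs)
    · exact isAlgebraic_adjoin_mono hr (hS' s hs)
  have hxy : IsAlgebraic (adjoin R (S ∪ S')) (x + y) :=
    (isAlgebraic_adjoin_mono hl hSx).add (isAlgebraic_adjoin_mono hr hSy)
  refine isDifferentiallyAlgebraic_of_finite (hSf.union hSf') hR hD ?_
  refine (derivation_isAlgebraic D hR hD hxy).mul ?_
  refine IsAlgebraic.of_mul
    (mem_nonZeroDivisors_of_ne_zero (left_ne_zero_of_mul_eq_one hu)) hxy ?_
  rw [hu]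
  exact isAlgebraic_one

end Algebra

/-! ### Polynomials fixed by a semilinear translation. -/

namespace MvPolynomial

variable {ι K : Type*} [Field K]

/-- The semilinear substitution `Xᵢ ↦ Xᵢ + rᵢ` acting on the coefficients by `s`. -/
noncomputable def translate (s : K →+* K) (r : ι → K) : MvPolynomial ι K →+* MvPolynomial ι K :=
  eval₂Hom (C.comp s) fun i => X i + C (r i)

@[simp]
theorem translate_C (s : K →+* K) (r : ι → K) (a : K) : translate s r (C a) = C (s a) := by
  simp [translate]

@[simp]
theorem translate_X (s : K →+* K) (r : ι → K) (i : ι) : translate s r (X i) = X i + C (r i) := by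
  simp [translate]

/-- This makes the ideal of algebraic relations between the `ψ i` stable under `translate s r`. -/
theorem aeval_translate {F : Type*} [Field F] [Algebra K F] {s : K →+* K} {T : F →+* F}
    (hT : ∀ k, T (algebraMap K F k) = algebraMap K F (s k)) {r : ι → K} {ψ : ι → F}
    (hψ : ∀ i, T (ψ i) = ψ i + algebraMap K F (r i)) (P : MvPolynomial ι K) :
    aeval ψ (translate s r P) = T (aeval ψ P) := by
  have : ((aeval ψ : MvPolynomial ι K →ₐ[K] F) : MvPolynomial ι K →+* F).comp (translate s r) =
      T.comp ((aeval ψ : MvPolynomial ι K →ₐ[K] F) : MvPolynomial ι K →+* F) := by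
    apply MvPolynomial.ringHom_ext
    · intro a; simp [hT]
    · intro i; simp [hψ]
  exact RingHom.congr_fun this P

theorem pderiv_translate (s : K →+* K) (r : ι → K) (i : ι) (P : MvPolynomial ι K) :
    pderiv i (translate s r P) = translate s r (pderiv i P) := by
  classical
  induction P using MvPolynomial.induction_on with
  | C a => simp
  | add p q hp hq => simp [hp, hq]
  | mul_X p j hp =>
    simp only [map_mul, map_add, translate_X, pderiv_mul, hp, pderiv_X, pderiv_C, add_zero]
    congr 2
    by_cases h : j = i <;> simp [h]

open MonomialOrder in
-- Up to the factor `s c`, the image is a product of monic factors `X i + C (r i)`, so its leading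
-- exponent is still `e`.
theorem translate_monomial (m : MonomialOrder ι) (s : K →+* K) (r : ι → K) (e : ι →₀ ℕ) (c : K) :
    m.toSyn (m.degree (translate s r (monomial e c))) ≤ m.toSyn e ∧
      coeff e (translate s r (monomial e c)) = s c := by
  have hmon : m.Monic (∏ i ∈ e.support, (X i + C (r i) : MvPolynomial ι K) ^ e i) :=
    Monic.prod fun i _ => (monic_X_add_C m i (r i)).pow
  have hdeg : m.degree (∏ i ∈ e.support, (X i + C (r i) : MvPolynomial ι K) ^ e i) = e := by
    rw [degree_prod fun i _ => pow_ne_zero _ (monic_X_add_C m i (r i)).ne_zero]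
    conv_rhs => rw [← e.sum_single]
    refine Finset.sum_congr rfl fun i _ => ?_
    rw [degree_pow, degree_X_add_C]
    simp
  have h : translate s r (monomial e c) =
      s c • ∏ i ∈ e.support, (X i + C (r i) : MvPolynomial ι K) ^ e i := by
    rw [monomial_eq, map_mul, translate_C, Finsupp.prod, map_prod, smul_eq_C_mul]
    simp
  constructor
  · rw [h]
    refine degree_smul_le.trans ?_
    rw [hdeg]
  · rw [h, coeff_smul]
    have := hmon.coeff_degree
    rw [hdeg] at this
    rw [this, smul_eq_mul, mul_one]

open MonomialOrder in
theorem degree_translate_le (m : MonomialOrder ι) (s : K →+* K) (r : ι → K)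
    (P : MvPolynomial ι K) :
    m.toSyn (m.degree (translate s r P)) ≤ m.toSyn (m.degree P) ∧
      coeff (m.degree P) (translate s r P) = s (m.leadingCoeff P) := by
  classical
  have h : translate s r P = ∑ e ∈ P.support, translate s r (monomial e (coeff e P)) := by
    conv_lhs => rw [P.as_sum, map_sum]
  constructor
  · rw [h]
    refine degree_sum_le.trans (Finset.sup_le fun e he => ?_)
    exact (translate_monomial m s r e _).1.trans (m.le_degree he)
  · rw [h, coeff_sum]
    rw [Finset.sum_eq_single (m.degree P)]
    · exact (translate_monomial m s r _ _).2
    · intro e he hne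
      apply coeff_eq_zero_of_lt (m := m)
      refine (translate_monomial m s r e _).1.trans_lt (lt_of_le_of_ne (m.le_degree he) ?_)
      simpa using hne
    · intro hP
      rw [notMem_support_iff.1 hP]
      simp

/-- A nonzero ideal stable under a translation contains a nonzero fixed polynomial. -/
theorem exists_translate_eq_self (m : MonomialOrder ι) (s : K →+* K) (r : ι → K)
    (I : Ideal (MvPolynomial ι K)) (hI : ∀ P ∈ I, translate s r P ∈ I) (hne : I ≠ ⊥) :
    ∃ P ∈ I, P ≠ 0 ∧ translate s r P = P := by
  obtain ⟨P₀, hP₀, hP₀'⟩ := Submodule.exists_mem_ne_zero_of_ne_bot hne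
  obtain ⟨P, ⟨hPI, hP0⟩, hmin⟩ := WellFounded.has_min
    (InvImage.wf (fun P : MvPolynomial ι K => m.toSyn (m.degree P))
      (wellFounded_lt (α := m.syn))) {P | P ∈ I ∧ P ≠ 0} ⟨P₀, hP₀, hP₀'⟩
  have hlc : m.leadingCoeff P ≠ 0 := MonomialOrder.leadingCoeff_ne_zero_iff.2 hP0
  -- Once the leading coefficient is `1`, which `s` fixes, the leading terms of `translate s r Q`
  -- and `Q` cancel; minimality then forces the difference to vanish.
  set Q := (m.leadingCoeff P)⁻¹ • P with hQ
  have hQd : m.degree Q = m.degree P :=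
    MonomialOrder.degree_smul_of_isRegular (IsRegular.of_ne_zero (inv_ne_zero hlc))
  have hQl : m.leadingCoeff Q = 1 := by
    rw [MonomialOrder.leadingCoeff, hQd, hQ, coeff_smul, smul_eq_mul]
    exact inv_mul_cancel₀ hlc
  have hQI : Q ∈ I := by
    rw [hQ, smul_eq_C_mul]
    exact I.mul_mem_left _ hPI
  have hQ0 : Q ≠ 0 := smul_ne_zero (inv_ne_zero hlc) hP0
  refine ⟨Q, hQI, hQ0, ?_⟩
  by_contra hcon
  obtain ⟨h1, h2⟩ := degree_translate_le m s r Q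
  rw [hQl, map_one] at h2
  have hd0 : translate s r Q - Q ≠ 0 := sub_ne_zero.2 hcon
  refine hmin (translate s r Q - Q) ⟨I.sub_mem (hI _ hQI) hQI, hd0⟩ ?_
  change m.toSyn (m.degree (translate s r Q - Q)) < m.toSyn (m.degree P)
  rw [← hQd]
  refine lt_of_le_of_ne (MonomialOrder.degree_sub_le.trans (sup_le h1 le_rfl)) fun h => ?_
  have h3 := MonomialOrder.leadingCoeff_ne_zero_iff (m := m).2 hd0
  rw [MonomialOrder.leadingCoeff, m.toSyn.injective h, coeff_sub, h2] at h3
  exact h3 (by rw [sub_eq_zero]; exact hQl.symm)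

theorem totalDegree_pderiv_lt {P : MvPolynomial ι K} (hP : P.totalDegree ≠ 0) (i : ι) :
    (pderiv i P).totalDegree < P.totalDegree := by
  refine (Finset.sup_lt_iff (Nat.pos_of_ne_zero hP)).2 fun e he => ?_
  have h : e + Finsupp.single i 1 ∈ P.support := by
    rw [mem_support_iff, coeff_pderiv] at he
    exact mem_support_iff.2 (left_ne_zero_of_mul he)
  have := le_totalDegree h
  rw [Finsupp.sum_add_index' (by simp) (by simp), Finsupp.sum_single_index rfl] at this
  omega

theorem exists_eq_C_of_pderiv_eq_zero [CharZero K] {P : MvPolynomial ι K}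
    (hP : ∀ i, pderiv i P = 0) : ∃ b, P = C b := by
  classical
  refine ⟨coeff 0 P, ?_⟩
  ext e
  rw [coeff_C]
  split_ifs with h
  · rw [h]
  · obtain ⟨i, hi⟩ := Finsupp.ne_iff.1 (Ne.symm h)
    have he : e - Finsupp.single i 1 + Finsupp.single i 1 = e :=
      tsub_add_cancel_of_le (by
        rw [Finsupp.single_le_iff]
        exact Nat.one_le_iff_ne_zero.2 hi)
    have := coeff_pderiv (i := i) P (e - Finsupp.single i 1)
    rw [hP i, coeff_zero, he] at this
    exact (mul_eq_zero.1 this.symm).resolve_right (Nat.cast_add_one_ne_zero _)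

/-- If a nonconstant polynomial is fixed by a translation, then so is one of degree one. -/
theorem exists_linear_relation_of_translate_eq_self [Fintype ι] [CharZero K] (s : K →+* K)
    (r : ι → K) {P : MvPolynomial ι K} (hP : translate s r P = P) (hdeg : P.totalDegree ≠ 0) :
    ∃ (c : ι → K) (b : K), c ≠ 0 ∧ (∀ i, s (c i) = c i) ∧ ∑ i, c i * r i = b - s b := by
  classical
  induction hn : P.totalDegree using Nat.strong_induction_on generalizing P with
  | _ n ih =>
  -- A nonconstant partial derivative is again fixed and has smaller degree. If all of them are
  -- constant, then `P` is affine.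
  by_cases h : ∃ i, (pderiv i P).totalDegree ≠ 0
  · obtain ⟨i, hi⟩ := h
    exact ih _ (hn ▸ totalDegree_pderiv_lt hdeg i) (by rw [← pderiv_translate, hP]) hi rfl
  push Not at h
  choose c hc using fun i => (⟨_, totalDegree_eq_zero_iff_eq_C.1 (h i)⟩ : ∃ c, pderiv i P = C c)
  have hQ : ∀ i, pderiv i (P - ∑ j, C (c j) * X j) = 0 := by
    intro i
    simp [pderiv_X, hc, Pi.single_apply]
  obtain ⟨b, hb⟩ := exists_eq_C_of_pderiv_eq_zero hQ
  have hPb : P = ∑ j, C (c j) * X j + C b := by rw [← hb]; ring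
  have hs : ∀ i, s (c i) = c i := by
    intro i
    have := pderiv_translate s r i P
    rw [hP, hc, translate_C] at this
    exact (C_injective _ _ this).symm
  refine ⟨c, b, ?_, hs, ?_⟩
  · rintro rfl
    apply hdeg
    rw [hPb]
    simp
  · rw [hPb] at hP
    simp only [map_add, map_sum, map_mul, translate_C, translate_X, hs, mul_add,
      Finset.sum_add_distrib] at hP
    apply C_injective ι K
    simp only [map_sub, map_sum, map_mul]
    linear_combination hP

/-- If the elements `ψ i` satisfy `T (ψ i) = ψ i + r i` for an endomorphism `T` and are
algebraically dependent, then a nontrivial combination of the `r i` with fixed coefficients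
is of the form `b - T b`. -/
theorem exists_linear_relation_of_translates {n : ℕ} [CharZero K] {F : Type*} [Field F]
    [Algebra K F] {s : K →+* K} {T : F →+* F}
    (hT : ∀ k, T (algebraMap K F k) = algebraMap K F (s k)) {r : Fin n → K} {ψ : Fin n → F}
    (hψ : ∀ i, T (ψ i) = ψ i + algebraMap K F (r i)) (hdep : ¬ AlgebraicIndependent K ψ) :
    ∃ (c : Fin n → K) (b : K), c ≠ 0 ∧ (∀ i, s (c i) = c i) ∧ ∑ i, c i * r i = b - s b := by
  obtain ⟨P, hPI, hP0, hP⟩ := exists_translate_eq_self MonomialOrder.lex s r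
    (RingHom.ker (aeval ψ : MvPolynomial (Fin n) K →ₐ[K] F))
    (fun P hP => by
      rw [RingHom.mem_ker] at hP ⊢
      rw [aeval_translate hT hψ, hP, map_zero])
    (fun h => hdep ((RingHom.injective_iff_ker_eq_bot _).2 h))
  refine exists_linear_relation_of_translate_eq_self s r hP fun h => hP0 ?_
  rw [totalDegree_eq_zero_iff_eq_C.1 h] at hPI ⊢
  rw [RingHom.mem_ker, aeval_C, map_eq_zero] at hPI
  rw [hPI, C_0]

end MvPolynomial

/-! ### Poles of rational functions under the shift. -/

namespace RatFunc

open Polynomial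

/-- The automorphism `f(z) ↦ f(z + 1)` of `ℂ(z)`. -/
noncomputable def shift : RatFunc ℂ ≃+* RatFunc ℂ :=
  IsFractionRing.ringEquivOfRingEquiv (taylorEquiv (1 : ℂ)).toRingEquiv

@[simp]
theorem shift_algebraMap (p : ℂ[X]) :
    shift (algebraMap ℂ[X] (RatFunc ℂ) p) = algebraMap ℂ[X] (RatFunc ℂ) (taylor 1 p) :=
  IsFractionRing.ringEquivOfRingEquiv_algebraMap _ _

/-- `x` has no pole at `w`. -/
def RegularAt (x : RatFunc ℂ) (w : ℂ) : Prop :=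
  ∃ p q : ℂ[X], q.eval w ≠ 0 ∧
    x * algebraMap ℂ[X] (RatFunc ℂ) q = algebraMap ℂ[X] (RatFunc ℂ) p

theorem RegularAt.sub {x y : RatFunc ℂ} {w : ℂ} (hx : RegularAt x w) (hy : RegularAt y w) :
    RegularAt (x - y) w := by
  obtain ⟨p, q, hq, h⟩ := hx
  obtain ⟨p', q', hq', h'⟩ := hy
  refine ⟨p * q' - p' * q, q * q', by simp [hq, hq'], ?_⟩
  simp only [map_mul, map_sub, ← h, ← h']
  ring

theorem regularAt_shift_iff {x : RatFunc ℂ} {w : ℂ} :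
    RegularAt (shift x) w ↔ RegularAt x (w + 1) := by
  constructor
  · rintro ⟨p, q, hq, h⟩
    obtain ⟨p, rfl⟩ := (taylorEquiv (1 : ℂ)).surjective p
    obtain ⟨q, rfl⟩ := (taylorEquiv (1 : ℂ)).surjective q
    refine ⟨p, q, ?_, ?_⟩
    · rw [← taylor_eval]; exact hq
    · apply shift.injective
      rw [map_mul, shift_algebraMap, shift_algebraMap]
      exact h
  · rintro ⟨p, q, hq, h⟩
    refine ⟨taylor 1 p, taylor 1 q, by rwa [taylor_eval], ?_⟩
    rw [← shift_algebraMap, ← shift_algebraMap, ← h, map_mul]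

theorem finite_setOf_not_regularAt (x : RatFunc ℂ) : {w | ¬ RegularAt x w}.Finite := by
  refine (x.denom.rootSet_finite ℂ).subset fun w hw => ?_
  rw [mem_rootSet_of_ne x.denom_ne_zero, coe_aeval_eq_eval]
  by_contra h
  refine hw ⟨x.num, x.denom, h, ?_⟩
  nth_rw 1 [← num_div_denom x]
  exact div_mul_cancel₀ _ (algebraMap_ne_zero x.denom_ne_zero)

/-- A pole at `w` would propagate along the whole progression `w + ε n`, but a rational function has
finitely many poles. -/
theorem regularAt_of_forall_add {x : RatFunc ℂ} {w : ℂ} {ε : ℂ} (hε : ε ≠ 0)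
    (h : ∀ n : ℕ, RegularAt x (w + ε * (n + 1)) → RegularAt x (w + ε * n)) : RegularAt x w := by
  by_contra hw
  have hn : ∀ n : ℕ, ¬ RegularAt x (w + ε * n) := by
    intro n
    induction n with
    | zero => simpa using hw
    | succ n ih =>
      rw [Nat.cast_succ]
      exact fun h' => ih (h n h')
  refine Set.infinite_of_injective_forall_mem (f := fun n : ℕ => w + ε * n) ?_ hn
    (finite_setOf_not_regularAt x)
  intro m n hmn
  simpa [hε] using hmn

theorem exists_eq_C_of_shift_eq_self {x : RatFunc ℂ} (hx : shift x = x) :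
    ∃ a : ℂ, x = algebraMap ℂ[X] (RatFunc ℂ) (Polynomial.C a) := by
  have hreg : ∀ w, RegularAt x w := by
    intro w
    refine regularAt_of_forall_add one_ne_zero fun n h => ?_
    rw [← hx, regularAt_shift_iff]
    convert! h using 1
    ring
  have hden : x.denom = 1 := by
    refine eq_one_of_monic_natDegree_zero (monic_denom x) ?_
    by_contra hdeg
    obtain ⟨w, hw⟩ := IsAlgClosed.exists_root x.denom 
      fun h => hdeg (natDegree_eq_of_degree_eq_some h)
    obtain ⟨p, q, hq, h⟩ := hreg w
    have h1 : x.num * q = p * x.denom := by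
      apply algebraMap_injective ℂ
      rw [map_mul, map_mul, ← h]
      nth_rw 2 [← num_div_denom x]
      field_simp [algebraMap_ne_zero x.denom_ne_zero]
    have hnum : x.num.eval w = 0 := by
      have := congrArg (Polynomial.eval w) h1
      rw [Polynomial.eval_mul, Polynomial.eval_mul, hw.eq_zero, mul_zero] at this
      exact (mul_eq_zero.1 this).resolve_right hq
    have hco := isCoprime_num_denom x
    obtain ⟨u, v, huv⟩ := hco
    have := congrArg (Polynomial.eval w) huv
    simp [hnum, hw.eq_zero] at this
  have hxn : x = algebraMap ℂ[X] (RatFunc ℂ) x.num := by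
    conv_lhs => rw [← num_div_denom x, hden, map_one, div_one]
  have htay : taylor 1 x.num = x.num := by
    apply algebraMap_injective ℂ
    rw [← shift_algebraMap, ← hxn, hx]
  refine ⟨x.num.eval 0, hxn.trans (congrArg _ ?_)⟩
  -- A 1-periodic polynomial takes its value at `0` at every natural number.
  refine Polynomial.eq_of_infinite_eval_eq _ _ ?_
  refine Set.infinite_of_injective_forall_mem (f := fun n : ℕ => (n : ℂ)) Nat.cast_injective ?_
  intro n
  rw [Set.mem_ofPred_eq, Polynomial.eval_C]
  induction n with
  | zero => simp
  | succ n ih => rw [← ih, Nat.cast_succ, ← taylor_eval, htay]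

/-- For `v ≠ w`, `b` has a pole at `v` iff it has one at `v + 1`. So poles propagate from `w` to the
left and from `w + 1` to the right without end, and finiteness makes `b` regular at both points. -/
theorem regularAt_of_sub_shift {b : RatFunc ℂ} {w : ℂ}
    (h : ∀ v ≠ w, RegularAt (b - shift b) v) : RegularAt (b - shift b) w := by
  have step : ∀ v ≠ w, (RegularAt b v ↔ RegularAt b (v + 1)) := by
    intro v hv
    rw [← regularAt_shift_iff]
    constructor
    · intro hb
      simpa using hb.sub (h v hv)
    · intro hb
      have := hb.sub (x := shift b) (y := shift b - b)
        (by simpa using RegularAt.sub (x := 0) ⟨0, 1, by simp, by simp⟩ (h v hv))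
      simpa using this
  refine RegularAt.sub ?_ ?_
  · refine regularAt_of_forall_add (neg_ne_zero.2 one_ne_zero) fun n hn => ?_
    refine (iff_of_eq (congrArg _ ?_)).mp ((step _ ?_).1 hn)
    · ring
    · intro hv
      have : ((n + 1 : ℕ) : ℂ) = 0 := by push_cast; linear_combination -hv
      exact absurd this (Nat.cast_ne_zero.2 n.succ_ne_zero)
  · rw [regularAt_shift_iff]
    refine regularAt_of_forall_add one_ne_zero fun n hn => ?_
    refine (step _ ?_).2 ((iff_of_eq (congrArg _ ?_)).mp hn)
    · intro hv
      have : ((n + 1 : ℕ) : ℂ) = 0 := by push_cast; linear_combination hv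
      exact absurd this (Nat.cast_ne_zero.2 n.succ_ne_zero)
    · ring

/-- A nontrivial combination with periodic coefficients of the principal parts
`a i / (z - w) ^ (i + 1)` is never of the form `b(z) - b(z + 1)`. -/
theorem sum_principal_parts_ne_sub_shift {N : ℕ} {w : ℂ} {a : Fin N → ℂ} (ha : ∀ i, a i ≠ 0)
    {r : Fin N → RatFunc ℂ}
    (hr : ∀ i, r i * algebraMap ℂ[X] (RatFunc ℂ) ((Polynomial.X - Polynomial.C w) ^ (i.1 + 1)) =
      algebraMap ℂ[X] (RatFunc ℂ) (Polynomial.C (a i)))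
    {c : Fin N → RatFunc ℂ} (hc : ∀ i, shift (c i) = c i) (hc0 : c ≠ 0) (b : RatFunc ℂ) :
    ∑ i, c i * r i ≠ b - shift b := by
  intro hsum
  choose γ hγ using fun i => exists_eq_C_of_shift_eq_self (hc i)
  -- The highest pole order that occurs is `k + 1`.
  obtain ⟨k, hk, hmax⟩ : ∃ k, γ k ≠ 0 ∧ ∀ i, k < i → γ i = 0 := by
    obtain ⟨i, hi⟩ := Function.ne_iff.1 hc0
    have hne : (Finset.univ.filter fun i => γ i ≠ 0).Nonempty :=
      ⟨i, by
        rw [Finset.mem_filter]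
        refine ⟨Finset.mem_univ _, fun h => hi ?_⟩
        rw [hγ, h]
        simp⟩
    refine ⟨_, (Finset.mem_filter.1 (Finset.max'_mem _ hne)).2, fun i hi => ?_⟩
    by_contra h
    exact absurd (Finset.le_max' _ i (Finset.mem_filter.2 ⟨Finset.mem_univ _, h⟩)) (not_le.2 hi)
  -- The numerator over `(X - w)^(k+1)`. The truncated exponent `k - i` is harmless for `i > k`,
  -- where `γ i = 0`; at `w` only the term `i = k` survives.
  set P : ℂ[X] := ∑ i, Polynomial.C (γ i * a i) * (Polynomial.X - Polynomial.C w) ^ (k.1 - i.1)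
    with hP
  have hPw : P.eval w ≠ 0 := by
    rw [hP, eval_finsetSum, Finset.sum_eq_single k]
    · simpa using ⟨hk, ha k⟩
    · intro i _ hik
      rcases lt_or_gt_of_ne hik with h | h
      · have : k.1 - i.1 ≠ 0 := by have : i.1 < k.1 := h; omega
        simp [this]
      · simp [hmax i h]
    · simp
  have hmul : (∑ i, c i * r i) *
      algebraMap ℂ[X] (RatFunc ℂ) ((Polynomial.X - Polynomial.C w) ^ (k.1 + 1)) =
      algebraMap ℂ[X] (RatFunc ℂ) P := by
    rw [hP, map_sum, Finset.sum_mul]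
    refine Finset.sum_congr rfl fun i _ => ?_
    rcases lt_or_ge k i with h | h
    · simp [hγ, hmax i h]
    · have : k.1 + 1 = (i.1 + 1) + (k.1 - i.1) := by have : i.1 ≤ k.1 := h; omega
      rw [this, pow_add, map_mul, mul_assoc, ← mul_assoc (r i), hr, hγ, ← mul_assoc, ← map_mul,
        ← map_mul, C_mul]
  rw [hsum] at hmul
  obtain ⟨p, q, hq, h⟩ := regularAt_of_sub_shift (b := b) (w := w) fun v hv =>
    ⟨P, _, by simp [sub_ne_zero.2 hv], hmul⟩
  have h1 : P * q = p * (Polynomial.X - Polynomial.C w) ^ (k.1 + 1) := by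
    apply algebraMap_injective ℂ
    rw [map_mul, map_mul, ← h, ← hmul]
    ring
  have := congrArg (Polynomial.eval w) h1
  simp [hPw, hq] at this

end RatFunc

/-! ### Difference equations that exclude differential algebraicity. -/

namespace Algebra

open Polynomial

theorem IsDifferentiallyAlgebraic.exists_fin {R A : Type*} [CommRing R] [CommRing A] [Algebra R A]
    {D : Derivation ℤ A A} {x : A} (hx : IsDifferentiallyAlgebraic R D x) :
    ∃ n, ¬ AlgebraicIndependent R (fun i : Fin n => D^[i] x) := by
  by_contra! h
  refine hx (algebraicIndependent_of_finite_type fun t ht => ?_)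
  obtain ⟨m, hm⟩ := ht.bddAbove
  exact (h (m + 1)).comp (fun i : t => ⟨i.1, Nat.lt_succ_of_le (hm i.2)⟩) fun i j hij =>
    Subtype.ext (congrArg Fin.val hij)

/-- Differential algebraicity is preserved by a semilinear injection commuting with `D`. -/
theorem IsDifferentiallyAlgebraic.map {R A : Type*} [CommRing R] [CommRing A] [Algebra R A]
    {D : Derivation ℤ A A} {s : R →+* R} (hs : Function.Injective s) {T : A →+* A}
    (hT : ∀ r, T (algebraMap R A r) = algebraMap R A (s r)) (hTD : ∀ x, T (D x) = D (T x))
    {x : A} (hx : IsDifferentiallyAlgebraic R D x) : IsDifferentiallyAlgebraic R D (T x) := by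
  intro hind
  refine hx ((injective_iff_map_eq_zero _).2 fun P hP => ?_)
  have hiter : ∀ i, T (D^[i] x) = D^[i] (T x) := fun i =>
    (Function.Semiconj.iterate_right (f := T) (ga := D) (gb := D) hTD i) x
  have h : ((MvPolynomial.aeval fun i : ℕ => D^[i] (T x) : MvPolynomial ℕ R →ₐ[R] A) :
      MvPolynomial ℕ R →+* A).comp (MvPolynomial.map s) =
      T.comp ((MvPolynomial.aeval fun i : ℕ => D^[i] x : MvPolynomial ℕ R →ₐ[R] A) :
        MvPolynomial ℕ R →+* A) := by
    apply MvPolynomial.ringHom_ext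
    · intro a; simp [hT]
    · intro i; simp [hiter]
  have h1 := RingHom.congr_fun h P
  simp only [RingHom.comp_apply, RingHom.coe_coe] at h1
  rw [hP, map_zero] at h1
  exact (map_eq_zero_iff _ (MvPolynomial.map_injective s hs)).1
    ((injective_iff_map_eq_zero _).1 hind _ h1)

variable {O : Type*} [CommRing O] [Algebra ℂ[X] O] {D : Derivation ℤ O O} {T : O →+* O}

theorem iterate_derivation_inv (hD : ∀ p : ℂ[X], D (algebraMap ℂ[X] O p) =
    algebraMap ℂ[X] O (derivative p)) {a : ℂ} {h : O}
    (hh : algebraMap ℂ[X] O (X - C a) * h = 1) (i : ℕ) :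
    D^[i] h = algebraMap ℂ[X] O (C ((-1) ^ i * i.factorial)) * h ^ (i + 1) := by
  have hDh : D h = - h ^ 2 := by
    have h1 := congrArg D hh
    rw [Derivation.leibniz, hD, Derivation.map_one_eq_zero] at h1
    simp only [derivative_sub, derivative_X, derivative_C, sub_zero, map_one, smul_eq_mul,
      mul_one] at h1
    linear_combination h * h1 - D h * hh
  induction i with
  | zero => simp
  | succ i ih =>
    rw [Function.iterate_succ_apply', ih, Derivation.leibniz, hD, derivative_C, map_zero, smul_zero,
      add_zero, Derivation.leibniz_pow, hDh, Nat.factorial_succ]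
    simp only [smul_eq_mul, nsmul_eq_mul, map_mul, map_pow, map_neg, map_one, map_natCast,
      Nat.cast_mul, Nat.cast_add, Nat.cast_one, map_add, Nat.add_sub_cancel]
    ring

/-- A solution of `ψ(z + 1) = ψ(z) + 1 / (z - a)` is not differentially algebraic. -/
theorem not_isDifferentiallyAlgebraic_of_map_eq_add_inv [IsDomain O] [FaithfulSMul ℂ[X] O]
    (hD : ∀ p : ℂ[X], D (algebraMap ℂ[X] O p) = algebraMap ℂ[X] O (derivative p))
    (hTi : Function.Injective T)
    (hT : ∀ p, T (algebraMap ℂ[X] O p) = algebraMap ℂ[X] O (taylor 1 p))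
    (hTD : ∀ x, T (D x) = D (T x)) {a : ℂ} {h ψ : O}
    (hh : algebraMap ℂ[X] O (X - C a) * h = 1) (hψ : T ψ = ψ + h) :
    ¬ IsDifferentiallyAlgebraic ℂ[X] D ψ := by
  intro hx
  obtain ⟨n, hn⟩ := hx.exists_fin
  -- The translation argument needs coefficients in a field, so `ℂ[X]` and `O` are replaced by
  -- `ℂ(z)` and `F`, with `T` extended to `F`.
  let F := FractionRing O
  have hRF : Function.Injective (algebraMap ℂ[X] F) := FaithfulSMul.algebraMap_injective _ _
  let φ : RatFunc ℂ →+* F := IsFractionRing.lift hRF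
  have hφ : ∀ p, φ (algebraMap ℂ[X] (RatFunc ℂ) p) = algebraMap ℂ[X] F p :=
    IsFractionRing.lift_algebraMap hRF
  let : Algebra (RatFunc ℂ) F := φ.toAlgebra
  have htower : IsScalarTower ℂ[X] (RatFunc ℂ) F :=
    IsScalarTower.of_algebraMap_eq fun p => (hφ p).symm
  let T' : F →+* F := IsFractionRing.map hTi
  have hT' : ∀ x, T' (algebraMap O F x) = algebraMap O F (T x) := fun x => IsLocalization.map_eq _ x
  have hTs : ∀ k, T' (algebraMap (RatFunc ℂ) F k) = algebraMap (RatFunc ℂ) F (RatFunc.shift k) := by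
    intro k
    have h1 : T'.comp (algebraMap (RatFunc ℂ) F) =
        (algebraMap (RatFunc ℂ) F).comp (RatFunc.shift : RatFunc ℂ →+* RatFunc ℂ) := by
      refine IsLocalization.ringHom_ext (nonZeroDivisors ℂ[X]) (RingHom.ext fun p => ?_)
      simp only [RingHom.comp_apply, ← IsScalarTower.algebraMap_apply ℂ[X] (RatFunc ℂ) F,
        RingHom.coe_coe, RatFunc.shift_algebraMap, IsScalarTower.algebraMap_apply ℂ[X] O F,
        hT', hT]
    exact RingHom.congr_fun h1 k
  let α : Fin n → ℂ := fun i => (-1) ^ i.1 * i.1.factorial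
  let r : Fin n → RatFunc ℂ := fun i => algebraMap ℂ[X] (RatFunc ℂ) (C (α i)) /
    algebraMap ℂ[X] (RatFunc ℂ) ((X - C a) ^ (i.1 + 1))
  have hne : ∀ i : Fin n, algebraMap ℂ[X] (RatFunc ℂ) ((X - C a) ^ (i.1 + 1)) ≠ 0 := fun i =>
    RatFunc.algebraMap_ne_zero (pow_ne_zero _ (X_sub_C_ne_zero a))
  have hr : ∀ i : Fin n, algebraMap (RatFunc ℂ) F (r i) = algebraMap O F (D^[i] h) := by
    intro i
    rw [iterate_derivation_inv hD hh, map_div₀, ← IsScalarTower.algebraMap_apply,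
      ← IsScalarTower.algebraMap_apply, div_eq_iff, IsScalarTower.algebraMap_apply ℂ[X] O F,
      IsScalarTower.algebraMap_apply ℂ[X] O F, ← map_mul (algebraMap O F), mul_assoc,
      map_pow (algebraMap ℂ[X] O), ← mul_pow, mul_comm h, hh, one_pow, mul_one]
    exact (map_ne_zero_iff _ hRF).2 (pow_ne_zero _ (X_sub_C_ne_zero a))
  have hiter : ∀ i x, T (D^[i] x) = D^[i] (T x) := fun i x =>
    (Function.Semiconj.iterate_right (f := T) (ga := D) (gb := D) hTD i) x
  obtain ⟨c, b, hc0, hc, hsum⟩ := MvPolynomial.exists_linear_relation_of_translates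
    (s := (RatFunc.shift : RatFunc ℂ →+* RatFunc ℂ)) (T := T') hTs (r := r)
    (ψ := fun i : Fin n => algebraMap O F (D^[i] ψ))
    (fun i => by rw [hT', hiter, hψ, iterate_map_add, map_add, hr])
    -- Independence over `ℂ(z)` in `F` would give independence over `ℂ[X]` in `O`.
    (fun hind => hn (AlgebraicIndependent.of_comp (IsScalarTower.toAlgHom ℂ[X] O F)
      (hind.restrictScalars (RatFunc.algebraMap_injective ℂ))))
  exact RatFunc.sum_principal_parts_ne_sub_shift (w := a) (a := α)
    (fun i => mul_ne_zero (pow_ne_zero _ (neg_ne_zero.2 one_ne_zero))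
      (Nat.cast_ne_zero.2 i.1.factorial_ne_zero))
    (r := r) (fun i => div_mul_cancel₀ _ (hne i)) hc hc0 b hsum

/-- If `x(z) + x(z + 1) = G(z)` with an invertible `G` such that `G(z + 1) = (z - a) G(z)`, then
`x` is not differentially algebraic. -/
theorem not_isDifferentiallyAlgebraic_of_add_map_eq [IsDomain O] [FaithfulSMul ℂ[X] O]
    (hD : ∀ p : ℂ[X], D (algebraMap ℂ[X] O p) = algebraMap ℂ[X] O (derivative p))
    (hTi : Function.Injective T)
    (hT : ∀ p, T (algebraMap ℂ[X] O p) = algebraMap ℂ[X] O (taylor 1 p))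
    (hTD : ∀ x, T (D x) = D (T x)) {a : ℂ} {h G u x : O}
    (hh : algebraMap ℂ[X] O (X - C a) * h = 1) (hG : T G = algebraMap ℂ[X] O (X - C a) * G)
    (hu : G * u = 1) (hx : x + T x = G) : ¬ IsDifferentiallyAlgebraic ℂ[X] D x := by
  intro hDA
  have : CharZero O := by
    refine ⟨fun m n hmn => ?_⟩
    have h1 : algebraMap ℂ[X] O m = algebraMap ℂ[X] O n := by simpa using hmn
    exact Nat.cast_injective (FaithfulSMul.algebraMap_injective ℂ[X] O h1)
  have hDA' : IsDifferentiallyAlgebraic ℂ[X] D (T x) :=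
    hDA.map (s := (taylorAlgHom (1 : ℂ) : ℂ[X] →+* ℂ[X])) (taylor_injective 1) hT hTD
  -- `D G * u` is the logarithmic derivative of `G`; the shift adds to it `h`, the logarithmic
  -- derivative of `X - C a`.
  have hψ := hDA.logDeriv_add (fun p => ⟨_, hD p⟩) hDA' (by rw [hx]; exact hu)
  refine not_isDifferentiallyAlgebraic_of_map_eq_add_inv hD hTi hT hTD hh ?_ hψ
  rw [hx]
  have hTu : T u = h * u := by
    have h1 : T G * T u = 1 := by rw [← map_mul, hu, map_one]
    rw [hG] at h1
    linear_combination (h * u) * h1 - T u * (hu + G * u * hh)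
  have hDG : D (T G) = G + algebraMap ℂ[X] O (X - C a) * D G := by
    rw [hG, Derivation.leibniz, hD]
    simp only [derivative_sub, derivative_X, derivative_C, sub_zero, map_one, smul_eq_mul]
    ring
  rw [map_mul, hTD, hTu, hDG]
  linear_combination h * hu + D G * u * hh

end Algebra

/-! ### The differential ring of holomorphic functions on the upper half plane. -/

namespace AlternatingKurepa

open Polynomial

/-- The upper half plane, as a set of complex numbers. -/
def upper : Set ℂ := {z | 0 < z.im}

theorem isOpen_upper : IsOpen upper := isOpen_lt continuous_const Complex.continuous_im

theorem convex_upper : Convex ℝ upper := convex_halfSpace_im_gt 0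

theorem add_one_mem_upper {z : ℂ} (hz : z ∈ upper) : z + 1 ∈ upper := by
  simpa [upper] using hz

theorem sub_one_mem_upper {z : ℂ} (hz : z ∈ upper) : z - 1 ∈ upper := by
  simpa [upper] using hz

/-- The algebra of holomorphic functions on the upper half plane. -/
noncomputable def holo : Subalgebra ℂ (upper → ℂ) where
  carrier := {f | ∃ g : ℂ → ℂ, DifferentiableOn ℂ g upper ∧ ∀ z, f z = g z}
  mul_mem' := by
    rintro _ _ ⟨f, hf, hf'⟩ ⟨g, hg, hg'⟩
    exact ⟨_, hf.mul hg, fun z => by simp [hf', hg']⟩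
  add_mem' := by
    rintro _ _ ⟨f, hf, hf'⟩ ⟨g, hg, hg'⟩
    exact ⟨_, hf.add hg, fun z => by simp [hf', hg']⟩
  algebraMap_mem' c := ⟨fun _ => c, differentiableOn_const c, fun _ => rfl⟩

namespace Holo

/-- The restriction of a function to the upper half plane. -/
def mk (g : ℂ → ℂ) (hg : DifferentiableOn ℂ g upper) : holo := ⟨fun z => g z, g, hg, fun _ => rfl⟩

theorem exists_mk (f : holo) : ∃ g hg, f = mk g hg := by
  obtain ⟨f, g, hg, h⟩ := f
  exact ⟨g, hg, Subtype.ext (funext h)⟩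

theorem mk_eq_mk {f g : ℂ → ℂ} {hf hg} : mk f hf = mk g hg ↔ Set.EqOn f g upper := by
  rw [Subtype.ext_iff, funext_iff]
  exact ⟨fun h z hz => h ⟨z, hz⟩, fun h z => h z.2⟩

theorem mk_mul {f g : ℂ → ℂ} (hf hg) : mk f hf * mk g hg = mk (fun z => f z * g z) (hf.mul hg) :=
  rfl

theorem mk_add {f g : ℂ → ℂ} (hf hg) : mk f hf + mk g hg = mk (fun z => f z + g z) (hf.add hg) :=
  rfl

theorem one_eq_mk : (1 : holo) = mk (fun _ => 1) (differentiableOn_const 1) := rfl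

theorem zero_eq_mk : (0 : holo) = mk (fun _ => 0) (differentiableOn_const 0) := rfl

instance : NoZeroDivisors holo where
  eq_zero_or_eq_zero_of_mul_eq_zero {x y} h := by
    obtain ⟨f, hf, rfl⟩ := exists_mk x
    obtain ⟨g, hg, rfl⟩ := exists_mk y
    rw [mk_mul, zero_eq_mk, mk_eq_mk] at h
    rw [zero_eq_mk, mk_eq_mk, mk_eq_mk]
    exact (hf.analyticOnNhd isOpen_upper).eq_zero_or_eq_zero_of_mul_eq_zero
      (hg.analyticOnNhd isOpen_upper) h convex_upper.isPreconnected

instance : Nontrivial holo := by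
  refine ⟨0, 1, fun h => ?_⟩
  rw [zero_eq_mk, one_eq_mk, mk_eq_mk] at h
  exact zero_ne_one (h (show Complex.I ∈ upper by simp [upper]))

instance : IsDomain holo := NoZeroDivisors.to_isDomain _

noncomputable instance algebraPolynomial : Algebra ℂ[X] holo :=
  RingHom.toAlgebra
    { toFun := fun p => mk (fun z => p.eval z) p.differentiable.differentiableOn
      map_one' := by rw [one_eq_mk, mk_eq_mk]; intro z _; simp
      map_zero' := by rw [zero_eq_mk, mk_eq_mk]; intro z _; simp
      map_mul' := fun p q => by rw [mk_mul, mk_eq_mk]; intro z _; simp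
      map_add' := fun p q => by rw [mk_add, mk_eq_mk]; intro z _; simp }

theorem algebraMap_eq (p : ℂ[X]) :
    algebraMap ℂ[X] holo p = mk (fun z => p.eval z) p.differentiable.differentiableOn := rfl

instance : FaithfulSMul ℂ[X] holo := by
  rw [faithfulSMul_iff_algebraMap_injective, injective_iff_map_eq_zero]
  intro p hp
  rw [algebraMap_eq, zero_eq_mk, mk_eq_mk] at hp
  refine Polynomial.eq_zero_of_infinite_isRoot p ?_
  refine Set.infinite_of_injective_forall_mem (f := fun n : ℕ => (n : ℂ) + Complex.I) ?_ ?_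
  · intro m n h
    simpa using h
  · intro n
    exact hp (by simp [upper])

/-- Differentiation of holomorphic functions. -/
noncomputable def deriv (f : holo) : holo :=
  mk (_root_.deriv f.2.choose) (f.2.choose_spec.1.deriv isOpen_upper)

/-- The chosen extension may differ from `f` off `upper`, but `upper` is open, so the two agree near
each of its points. -/
theorem deriv_mk {f : ℂ → ℂ} (hf) :
    deriv (mk f hf) = mk (_root_.deriv f) (hf.deriv isOpen_upper) := by
  rw [deriv, mk_eq_mk]
  intro z hz
  refine Filter.EventuallyEq.deriv_eq ?_
  filter_upwards [isOpen_upper.mem_nhds hz] with w hw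
  exact ((mk f hf).2.choose_spec.2 ⟨w, hw⟩).symm

/-- Differentiation as a derivation. -/
noncomputable def derivation : Derivation ℤ holo holo :=
  Derivation.mk'
    (AddMonoidHom.toIntLinearMap
      { toFun := deriv
        map_zero' := by
          rw [zero_eq_mk, deriv_mk, mk_eq_mk]
          intro z _
          simp
        map_add' := fun x y => by
          obtain ⟨f, hf, rfl⟩ := exists_mk x
          obtain ⟨g, hg, rfl⟩ := exists_mk y
          rw [mk_add, deriv_mk, deriv_mk, deriv_mk, mk_add, mk_eq_mk]
          intro z hz
          exact deriv_fun_add (hf.differentiableAt (isOpen_upper.mem_nhds hz))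
            (hg.differentiableAt (isOpen_upper.mem_nhds hz)) })
    (fun x y => by
      obtain ⟨f, hf, rfl⟩ := exists_mk x
      obtain ⟨g, hg, rfl⟩ := exists_mk y
      change deriv (mk f hf * mk g hg) = mk f hf * deriv (mk g hg) + mk g hg * deriv (mk f hf)
      rw [mk_mul, deriv_mk, deriv_mk, deriv_mk, mk_mul, mk_mul, mk_add, mk_eq_mk]
      intro z hz
      refine (deriv_fun_mul (hf.differentiableAt (isOpen_upper.mem_nhds hz))
        (hg.differentiableAt (isOpen_upper.mem_nhds hz))).trans ?_
      ring)

theorem derivation_mk {f : ℂ → ℂ} (hf) :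
    derivation (mk f hf) = mk (_root_.deriv f) (hf.deriv isOpen_upper) := deriv_mk hf

theorem iterate_derivation_mk {f : ℂ → ℂ} (hf) (n : ℕ) :
    ∃ h, derivation^[n] (mk f hf) = mk (iteratedDeriv n f) h := by
  induction n with
  | zero => exact ⟨by simpa using hf, by simp⟩
  | succ n ih =>
    obtain ⟨h, ih⟩ := ih
    refine ⟨by rw [iteratedDeriv_succ]; exact h.deriv isOpen_upper, ?_⟩
    rw [Function.iterate_succ_apply', ih, derivation_mk, mk_eq_mk, iteratedDeriv_succ]
    exact Set.eqOn_refl _ _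

theorem differentiableOn_comp_add_one {f : ℂ → ℂ} (hf : DifferentiableOn ℂ f upper) :
    DifferentiableOn ℂ (fun z => f (z + 1)) upper :=
  hf.comp (differentiable_id.add_const 1).differentiableOn fun _ => add_one_mem_upper

/-- The shift `f(z) ↦ f(z + 1)`. -/
def shift : holo →+* holo where
  toFun f := ⟨fun z => f.1 ⟨z + 1, add_one_mem_upper z.2⟩, fun z => f.2.choose (z + 1),
    differentiableOn_comp_add_one f.2.choose_spec.1, fun _ => f.2.choose_spec.2 _⟩
  map_one' := rfl
  map_zero' := rfl
  map_mul' _ _ := rfl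
  map_add' _ _ := rfl

theorem shift_mk {f : ℂ → ℂ} (hf) :
    shift (mk f hf) = mk (fun z => f (z + 1)) (differentiableOn_comp_add_one hf) := rfl

theorem shift_injective : Function.Injective shift := by
  rw [injective_iff_map_eq_zero]
  intro x hx
  obtain ⟨f, hf, rfl⟩ := exists_mk x
  rw [shift_mk, zero_eq_mk, mk_eq_mk] at hx
  rw [zero_eq_mk, mk_eq_mk]
  intro z hz
  simpa using hx (sub_one_mem_upper hz)

theorem shift_algebraMap (p : ℂ[X]) :
    shift (algebraMap ℂ[X] holo p) = algebraMap ℂ[X] holo (taylor 1 p) := by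
  rw [algebraMap_eq, shift_mk, algebraMap_eq, mk_eq_mk]
  intro z _
  exact (taylor_eval 1 p z).symm

theorem derivation_algebraMap (p : ℂ[X]) :
    derivation (algebraMap ℂ[X] holo p) = algebraMap ℂ[X] holo (derivative p) := by
  rw [algebraMap_eq, derivation_mk, algebraMap_eq, mk_eq_mk]
  intro z _
  exact p.deriv

theorem shift_derivation (x : holo) : shift (derivation x) = derivation (shift x) := by
  obtain ⟨f, hf, rfl⟩ := exists_mk x
  rw [derivation_mk, shift_mk, shift_mk, derivation_mk, mk_eq_mk]
  intro z _
  exact (deriv_comp_add_const f 1 z).symm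

theorem ne_ofReal {z : ℂ} (hz : z ∈ upper) (a : ℝ) : z ≠ a := by
  rintro rfl
  simp [upper] at hz

/-- A holomorphic function on the upper half plane with `f(z) + f(z + 1) = Γ(z + 2)` is not
differentially algebraic over the polynomials. -/
theorem not_isDifferentiallyAlgebraic {f : ℂ → ℂ} (hf : DifferentiableOn ℂ f upper)
    (hfe : ∀ z ∈ upper, f z + f (z + 1) = Complex.Gamma (z + 2)) :
    ¬ Algebra.IsDifferentiallyAlgebraic ℂ[X] derivation (mk f hf) := by
  have hne : ∀ z ∈ upper, z + 2 ≠ 0 := by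
    intro z hz h
    refine ne_ofReal hz (-2) ?_
    push_cast
    linear_combination h
  have hpole : ∀ z ∈ upper, ∀ m : ℕ, z + 2 ≠ -m := by
    intro z hz m h
    refine ne_ofReal hz (-m - 2) ?_
    push_cast
    linear_combination h
  have hG : DifferentiableOn ℂ (fun z => Complex.Gamma (z + 2)) upper := fun z hz =>
    ((Complex.differentiableAt_Gamma (z + 2) (hpole z hz)).comp z
      (differentiableAt_id.add_const 2)).differentiableWithinAt
  have hu : DifferentiableOn ℂ (fun z => (Complex.Gamma (z + 2))⁻¹) upper :=
    (Complex.differentiable_one_div_Gamma.comp (differentiable_id.add_const 2)).differentiableOn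
  have hh : DifferentiableOn ℂ (fun z => (z + 2)⁻¹) upper :=
    (differentiable_id.add_const 2).differentiableOn.inv hne
  -- For `G(z) = Γ(z+2)` the functional equation reads `G(z+1) = (z+2) G(z)`, hence `a = -2`.
  refine Algebra.not_isDifferentiallyAlgebraic_of_add_map_eq derivation_algebraMap
    shift_injective shift_algebraMap shift_derivation (a := -2) (h := mk _ hh) (G := mk _ hG)
    (u := mk _ hu) ?_ ?_ ?_ ?_
  · rw [algebraMap_eq, mk_mul, one_eq_mk, mk_eq_mk]
    intro z hz
    simpa using mul_inv_cancel₀ (hne z hz)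
  · rw [algebraMap_eq, shift_mk, mk_mul, mk_eq_mk]
    intro z hz
    have := Complex.Gamma_add_one (z + 2) (hne z hz)
    simp only [eval_sub, eval_X, eval_C, sub_neg_eq_add]
    rw [← this]
    ring_nf
  · rw [mk_mul, one_eq_mk, mk_eq_mk]
    intro z hz
    exact mul_inv_cancel₀ (Complex.Gamma_ne_zero (hpole z hz))
  · rw [shift_mk, mk_add, mk_eq_mk]
    exact hfe

end Holo

end AlternatingKurepa

/-! ### From an equation on a domain to the upper half plane. -/

namespace AlternatingKurepa

open Polynomial Filter Topology

theorem rank_real_complex_gt_one : 1 < Module.rank ℝ ℂ := by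
  rw [Complex.rank_real_complex]
  norm_num

theorem isPreconnected_compl_range_intCast : IsPreconnected (Set.range (Int.cast : ℤ → ℂ))ᶜ :=
  ((Set.countable_range _).isPathConnected_compl_of_one_lt_rank
    rank_real_complex_gt_one).isConnected.isPreconnected

theorem upper_subset_compl_range_intCast : upper ⊆ (Set.range (Int.cast : ℤ → ℂ))ᶜ := by
  rintro _ hz ⟨n, rfl⟩
  simp [upper] at hz

attribute [local instance] MvPolynomial.algebraMvPolynomial in
/-- A polynomial over `ℂ(z)` has a nonzero multiple with coefficients in `ℂ[z]`. -/
theorem exists_clear_denominators {P : MvPolynomial ℕ (RatFunc ℂ)} (hP : P ≠ 0) :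
    ∃ (Q : MvPolynomial ℕ ℂ[X]) (b : ℂ[X]), Q ≠ 0 ∧ Q.support = P.support ∧
      ∀ m, algebraMap ℂ[X] (RatFunc ℂ) (Q.coeff m) =
        P.coeff m * algebraMap ℂ[X] (RatFunc ℂ) b := by
  obtain ⟨⟨Q, ⟨_, b, hb, rfl⟩⟩, h⟩ := IsLocalization.surj
    ((nonZeroDivisors ℂ[X]).map (MvPolynomial.C (σ := ℕ))) P
  have hb0 : algebraMap ℂ[X] (RatFunc ℂ) b ≠ 0 :=
    RatFunc.algebraMap_ne_zero (nonZeroDivisors.ne_zero hb)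
  have hcoeff : ∀ m, algebraMap ℂ[X] (RatFunc ℂ) (Q.coeff m) =
      P.coeff m * algebraMap ℂ[X] (RatFunc ℂ) b := by
    intro m
    have := congrArg (MvPolynomial.coeff m) h
    simp only [MvPolynomial.algebraMap_def, MvPolynomial.coeff_map] at this
    rw [← this, MvPolynomial.map_C, mul_comm, MvPolynomial.coeff_C_mul, mul_comm]
  have hsupp : Q.support = P.support := by
    ext m
    rw [MvPolynomial.mem_support_iff, MvPolynomial.mem_support_iff, not_iff_not,
      ← map_eq_zero_iff _ (RatFunc.algebraMap_injective ℂ), hcoeff, mul_eq_zero,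
      or_iff_left hb0]
  refine ⟨Q, b, ?_, hsupp, hcoeff⟩
  rwa [← MvPolynomial.support_nonempty, hsupp, MvPolynomial.support_nonempty]

/-- `RatFunc.eval` is a quotient of values with default `0` at the zeros of the denominator, so
those points are excluded. -/
theorem eval_eq_of_algebraMap_eq {x : RatFunc ℂ} {p b : ℂ[X]} {z : ℂ}
    (h : algebraMap ℂ[X] (RatFunc ℂ) p = x * algebraMap ℂ[X] (RatFunc ℂ) b)
    (hz : x.denom.eval z ≠ 0) : p.eval z = x.eval (RingHom.id ℂ) z * b.eval z := by
  have h1 : p * x.denom = x.num * b := by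
    apply RatFunc.algebraMap_injective ℂ
    have h0 : algebraMap ℂ[X] (RatFunc ℂ) x.denom ≠ 0 :=
      RatFunc.algebraMap_ne_zero x.denom_ne_zero
    have h2 : x * algebraMap ℂ[X] (RatFunc ℂ) x.denom = algebraMap ℂ[X] (RatFunc ℂ) x.num := by
      nth_rw 1 [← RatFunc.num_div_denom x]
      exact div_mul_cancel₀ _ h0
    rw [map_mul, map_mul, h, ← h2]
    ring
  have h2 := congrArg (Polynomial.eval z) h1
  rw [Polynomial.eval_mul, Polynomial.eval_mul] at h2
  rw [RatFunc.eval, Polynomial.eval₂_id, Polynomial.eval₂_id]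
  field_simp
  exact h2

/-- The value at `z` of `Q(f, f', …)` for a polynomial `Q` with coefficients in `ℂ[z]`. -/
noncomputable def polyDiffEval (Q : MvPolynomial ℕ ℂ[X]) (f : ℂ → ℂ) (z : ℂ) : ℂ :=
  ∑ m ∈ Q.support, (Q.coeff m).eval z * ∏ i ∈ m.support, iteratedDeriv i f z ^ m i

theorem polyDiffEval_eq_mul {P : MvPolynomial ℕ (RatFunc ℂ)} {Q : MvPolynomial ℕ ℂ[X]} {b : ℂ[X]}
    (hsupp : Q.support = P.support)
    (h : ∀ m, algebraMap ℂ[X] (RatFunc ℂ) (Q.coeff m) =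
      P.coeff m * algebraMap ℂ[X] (RatFunc ℂ) b) (f : ℂ → ℂ) {z : ℂ}
    (hz : ∀ m ∈ P.support, (P.coeff m).denom.eval z ≠ 0) :
    polyDiffEval Q f z = b.eval z * diffPolyEval P f z := by
  rw [polyDiffEval, diffPolyEval, hsupp, Finset.mul_sum]
  refine Finset.sum_congr rfl fun m hm => ?_
  rw [eval_eq_of_algebraMap_eq (h m) (hz m hm)]
  ring

theorem analyticOnNhd_polyDiffEval {U : Set ℂ} (Q : MvPolynomial ℕ ℂ[X]) {f : ℂ → ℂ}
    (hf : AnalyticOnNhd ℂ f U) : AnalyticOnNhd ℂ (polyDiffEval Q f) U := by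
  intro z hz
  refine Finset.analyticAt_fun_sum _ fun m _ => AnalyticAt.mul ?_ ?_
  · exact (Q.coeff m).differentiable.analyticAt z
  · refine Finset.analyticAt_fun_prod _ fun i _ => AnalyticAt.pow ?_ _
    simpa only [iteratedDeriv_eq_iterate] using (hf z hz).iterated_deriv i

theorem aeval_iterate_derivation_mk (Q : MvPolynomial ℕ ℂ[X]) {f : ℂ → ℂ}
    (hf : DifferentiableOn ℂ f upper) (z : upper) :
    (MvPolynomial.aeval (fun i : ℕ => Holo.derivation^[i] (Holo.mk f hf)) Q : holo).1 z =
      polyDiffEval Q f z := by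
  have hev : ∀ x : holo, x.1 z = ((Pi.evalRingHom (fun _ : upper => ℂ) z).comp
    holo.val.toRingHom) x := fun _ => rfl
  rw [hev, MvPolynomial.aeval_def, MvPolynomial.eval₂_eq, map_sum, polyDiffEval]
  refine Finset.sum_congr rfl fun m _ => ?_
  rw [map_mul, map_prod]
  congr 1
  refine Finset.prod_congr rfl fun i _ => ?_
  obtain ⟨h, hi⟩ := Holo.iterate_derivation_mk hf i
  rw [map_pow, hi]
  rfl

/-- A function holomorphic off the integers which satisfies an algebraic differential equation on
some domain is differentially algebraic on the upper half plane. -/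
theorem SatisfiesADE.isDifferentiallyAlgebraic {D : Set ℂ} (hD : IsOpen D) (hne : D.Nonempty)
    {f : ℂ → ℂ} (hf : AnalyticOnNhd ℂ f (Set.range (Int.cast : ℤ → ℂ))ᶜ) (h : SatisfiesADE D f)
    (hfu : DifferentiableOn ℂ f upper) :
    Algebra.IsDifferentiallyAlgebraic ℂ[X] Holo.derivation (Holo.mk f hfu) := by
  obtain ⟨P, hP, hPD⟩ := h
  obtain ⟨Q, b, hQ, hsupp, hcoeff⟩ := exists_clear_denominators hP
  obtain ⟨z₀, hz₀D, hz₀⟩ := ((Set.countable_range (Int.cast : ℤ → ℂ)).dense_compl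
    ℝ).inter_open_nonempty D hD hne
  have h1 : ∀ᶠ z in 𝓝[≠] z₀, diffPolyEval P f z = 0 := by
    have := mem_codiscreteWithin_iff_forall_mem_nhdsNE.1 hPD z₀ hz₀D
    filter_upwards [this, mem_nhdsWithin_of_mem_nhds (hD.mem_nhds hz₀D)] with z hz hzD
    exact hz.resolve_right fun hn => hn hzD
  have h2 : ∀ᶠ z in 𝓝[≠] z₀, ∀ m ∈ P.support, (P.coeff m).denom.eval z ≠ 0 := by
    rw [eventually_all_finset]
    intro m _
    refine nhdsNE_le_cofinite z₀ ?_
    have := (P.coeff m).denom.rootSet_finite ℂ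
    refine (this.subset fun z hz => ?_ : Set.Finite _)
    rw [mem_rootSet_of_ne (P.coeff m).denom_ne_zero, coe_aeval_eq_eval]
    simpa using hz
  -- Clearing denominators made the expression analytic off the integers, so its vanishing near `z₀`
  -- spreads over the connected set `ℂ ∖ ℤ`.
  have h3 : Set.EqOn (polyDiffEval Q f) 0 (Set.range (Int.cast : ℤ → ℂ))ᶜ := by
    refine (analyticOnNhd_polyDiffEval Q hf).eqOn_zero_of_preconnected_of_frequently_eq_zero
      isPreconnected_compl_range_intCast hz₀ (Eventually.frequently ?_)
    filter_upwards [h1, h2] with z hz hz'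
    rw [polyDiffEval_eq_mul hsupp hcoeff f hz', hz, mul_zero]
  intro hind
  refine hQ ((injective_iff_map_eq_zero _).1 hind Q (Subtype.ext (funext fun z => ?_)))
  exact (aeval_iterate_derivation_mk Q hfu z).trans (h3 (upper_subset_compl_range_intCast z.2))

/-- A function holomorphic off the integers with `f(z) + f(z + 1) = Γ(z + 2)` satisfies no
algebraic differential equation. -/
theorem not_satisfiesADE {D : Set ℂ} (hD : IsOpen D) (hne : D.Nonempty) {f : ℂ → ℂ}
    (hf : AnalyticOnNhd ℂ f (Set.range (Int.cast : ℤ → ℂ))ᶜ)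
    (hfe : ∀ z ∈ upper, f z + f (z + 1) = Complex.Gamma (z + 2)) : ¬ SatisfiesADE D f := by
  intro h
  have hfu : DifferentiableOn ℂ f upper := fun z hz =>
    (hf z (upper_subset_compl_range_intCast hz)).differentiableAt.differentiableWithinAt
  exact Holo.not_isDifferentiallyAlgebraic hfu hfe (h.isDifferentiallyAlgebraic hD hne hf hfu)

end AlternatingKurepa

/-! ### The function `A`: functional equation, continuation, analyticity. -/

namespace AlternatingKurepa

open Filter Topology MeasureTheory

/-- The weight `e^{-t} / (t + 1)`, whose Mellin transform gives the alternating Kurepa function. -/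
noncomputable def weight (t : ℝ) : ℂ := (Real.exp (-t) : ℂ) / ((t : ℂ) + 1)

theorem ofReal_add_one_ne_zero {t : ℝ} (ht : 0 ≤ t) : (t : ℂ) + 1 ≠ 0 := by
  have : ((t + 1 : ℝ) : ℂ) ≠ 0 := Complex.ofReal_ne_zero.2 (by positivity)
  simpa using this

theorem continuousOn_weight : ContinuousOn weight (Set.Ici 0) :=
  ContinuousOn.div (by fun_prop) (by fun_prop) fun _ ht => ofReal_add_one_ne_zero ht

theorem norm_weight_le {t : ℝ} (ht : 0 ≤ t) : ‖weight t‖ ≤ Real.exp (-t) := by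
  have h : ‖(t : ℂ) + 1‖ = t + 1 := by
    rw [← Complex.ofReal_one, ← Complex.ofReal_add, Complex.norm_real, Real.norm_of_nonneg]
    positivity
  rw [weight, norm_div, h, Complex.norm_real, Real.norm_of_nonneg (Real.exp_pos _).le]
  exact div_le_self (Real.exp_pos _).le (by linarith)

theorem weight_isBigO_atTop : weight =O[atTop] fun t => Real.exp (-1 * t) := by
  refine Asymptotics.IsBigO.of_bound 1 ?_
  filter_upwards [eventually_ge_atTop 0] with t ht
  rw [one_mul, Real.norm_of_nonneg (Real.exp_pos _).le, neg_one_mul]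
  exact norm_weight_le ht

theorem weight_isBigO_zero : weight =O[𝓝[>] 0] fun t : ℝ => t ^ (-(0 : ℝ)) := by
  refine Asymptotics.IsBigO.of_bound 1 ?_
  filter_upwards [self_mem_nhdsWithin] with t ht
  rw [neg_zero, Real.rpow_zero, norm_one, one_mul]
  exact (norm_weight_le (le_of_lt ht)).trans (Real.exp_le_one_iff.2 (by simpa using le_of_lt ht))

theorem locallyIntegrableOn_weight : LocallyIntegrableOn weight (Set.Ioi 0) :=
  (continuousOn_weight.mono Set.Ioi_subset_Ici_self).locallyIntegrableOn measurableSet_Ioi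

theorem mellinConvergent_weight {s : ℂ} (hs : 0 < s.re) : MellinConvergent weight s :=
  mellinConvergent_of_isBigO_rpow_exp one_pos locallyIntegrableOn_weight weight_isBigO_atTop
    weight_isBigO_zero hs

theorem differentiableAt_mellin_weight {s : ℂ} (hs : 0 < s.re) :
    DifferentiableAt ℂ (mellin weight) s :=
  mellin_differentiableAt_of_isBigO_rpow_exp one_pos locallyIntegrableOn_weight
    weight_isBigO_atTop weight_isBigO_zero hs

/-- Passing from `s` to `s + 1` multiplies the integrand by `t`, so the sum cancels the denominator
`t + 1` and leaves Euler's integral. -/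
theorem mellin_weight_add {s : ℂ} (hs : 0 < s.re) :
    mellin weight s + mellin weight (s + 1) = Complex.Gamma s := by
  have hs' : 0 < (s + 1).re := by rw [Complex.add_re, Complex.one_re]; linarith
  rw [mellin, mellin, ← integral_add (mellinConvergent_weight hs) (mellinConvergent_weight hs'),
    Complex.Gamma_eq_integral hs, Complex.GammaIntegral]
  refine setIntegral_congr_fun measurableSet_Ioi fun t ht => ?_
  have ht0 : (t : ℂ) ≠ 0 := Complex.ofReal_ne_zero.2 (ne_of_gt ht)
  have ht1 := ofReal_add_one_ne_zero (le_of_lt ht)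
  have h : (t : ℂ) ^ (s + 1 - 1) = (t : ℂ) ^ (s - 1) * t := by
    rw [show s + 1 - 1 = s - 1 + 1 by ring, Complex.cpow_add _ _ ht0, Complex.cpow_one]
  simp only [smul_eq_mul, h, weight]
  field_simp
  ring

theorem kurepaIntegral_eq {z : ℂ} (hz : 0 < z.re) :
    kurepaIntegral z = mellin weight (z + 2) - (-1) ^ z * mellin weight 2 := by
  have hz' : 0 < (z + 2).re := by simp; linarith
  rw [mellin, mellin, ← integral_const_mul, ← integral_sub (mellinConvergent_weight hz')
    ((mellinConvergent_weight (s := 2) (by simp)).const_mul _), kurepaIntegral]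
  refine setIntegral_congr_fun measurableSet_Ioi fun t ht => ?_
  have h2 : (2 : ℂ) - 1 = 1 := by norm_num
  have hz2 : z + 2 - 1 = z + 1 := by ring
  simp only [smul_eq_mul, h2, hz2, Complex.cpow_one, weight]
  ring

/-- The terms with `(-1)^z` cancel, as `(-1)^(z+1) = -(-1)^z`. -/
theorem kurepaIntegral_add {z : ℂ} (hz : 0 < z.re) :
    kurepaIntegral z + kurepaIntegral (z + 1) = Complex.Gamma (z + 2) := by
  have hz1 : 0 < (z + 1).re := by simp; linarith
  have hz2 : 0 < (z + 2).re := by simp; linarith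
  rw [kurepaIntegral_eq hz, kurepaIntegral_eq hz1, ← mellin_weight_add hz2,
    Complex.cpow_add _ _ (neg_ne_zero.2 one_ne_zero), Complex.cpow_one,
    show z + 1 + 2 = z + 2 + 1 by ring]
  ring

theorem differentiableAt_kurepaIntegral {z : ℂ} (hz : 0 < z.re) :
    DifferentiableAt ℂ kurepaIntegral z := by
  have hz2 : 0 < (z + 2).re := by simp; linarith
  have h : DifferentiableAt ℂ (fun z => mellin weight (z + 2) - (-1) ^ z * mellin weight 2) z := by
    refine DifferentiableAt.sub ?_ (DifferentiableAt.mul_const ?_ _)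
    · exact DifferentiableAt.comp (g := mellin weight) (f := fun z : ℂ => z + 2) z
        (differentiableAt_mellin_weight hz2) (differentiableAt_id.add_const 2)
    · exact differentiableAt_id.const_cpow (Or.inl (neg_ne_zero.2 one_ne_zero))
  refine h.congr_of_eventuallyEq ?_
  filter_upwards [(isOpen_lt continuous_const Complex.continuous_re).mem_nhds hz] with w hw
  exact kurepaIntegral_eq hw

/-- The `n`-fold continuation of the integral. -/
noncomputable def kurepaStep (n : ℕ) (z : ℂ) : ℂ :=
  (-1) ^ n * kurepaIntegral (z + n) +
    ∑ k ∈ Finset.range n, (-1) ^ k * Complex.Gamma (z + k + 2)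

theorem kurepaStep_succ {n : ℕ} {z : ℂ} (hz : 0 < (z + n).re) :
    kurepaStep (n + 1) z = kurepaStep n z := by
  rw [kurepaStep, kurepaStep, Finset.sum_range_succ, ← kurepaIntegral_add hz]
  push_cast
  ring_nf

theorem shiftSteps_le_iff {z : ℂ} {n : ℕ} : shiftSteps z ≤ n ↔ 0 < (z + n).re := by
  rw [shiftSteps, Int.toNat_le, Int.add_one_le_iff, Int.floor_lt, Complex.add_re,
    Complex.natCast_re, Int.cast_natCast, neg_lt_iff_pos_add']

/-- `shiftSteps` jumps with `z`; extra steps do not change the value, so near each point a single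
fixed `n` can be used. -/
theorem kurepaA_eq_kurepaStep {z : ℂ} {n : ℕ} (hz : 0 < (z + n).re) :
    kurepaA z = kurepaStep n z := by
  have hn : shiftSteps z ≤ n := shiftSteps_le_iff.2 hz
  clear hz
  induction n, hn using Nat.le_induction with
  | base => rfl
  | succ n hn ih => rw [kurepaStep_succ (shiftSteps_le_iff.1 hn), ih]

theorem exists_nat_add_re_pos (z : ℂ) : ∃ n : ℕ, 0 < (z + n).re :=
  ⟨_, shiftSteps_le_iff.1 le_rfl⟩

theorem kurepaA_eventuallyEq {z : ℂ} {n : ℕ} (hz : 0 < (z + n).re) :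
    kurepaA =ᶠ[𝓝 z] kurepaStep n := by
  have : IsOpen {w : ℂ | 0 < (w + n).re} :=
    isOpen_lt continuous_const (Complex.continuous_re.comp (continuous_add_const _))
  filter_upwards [this.mem_nhds hz] with w hw
  exact kurepaA_eq_kurepaStep hw

theorem kurepaA_add (z : ℂ) : kurepaA z + kurepaA (z + 1) = Complex.Gamma (z + 2) := by
  -- With `n` steps at `z + 1` and `n + 1` at `z`, the integrals have the same argument and opposite
  -- signs, and the sums cancel except for the `k = 0` term `Γ(z+2)`.
  obtain ⟨n, hn⟩ := exists_nat_add_re_pos (z + 1)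
  have hn' : 0 < (z + (n + 1 : ℕ)).re := by
    rwa [Nat.cast_succ, add_comm (n : ℂ), ← add_assoc]
  rw [kurepaA_eq_kurepaStep hn, kurepaA_eq_kurepaStep hn', kurepaStep, kurepaStep,
    Finset.sum_range_succ', add_comm (n : ℕ) 1]
  push_cast
  have : ∀ k : ℕ, (-1 : ℂ) ^ (k + 1) * Complex.Gamma (z + (k + 1) + 2) =
      -((-1) ^ k * Complex.Gamma (z + 1 + k + 2)) := by
    intro k
    rw [pow_succ, show z + ((k : ℂ) + 1) + 2 = z + 1 + k + 2 by ring]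
    ring
  rw [Finset.sum_congr rfl fun k _ => this k, Finset.sum_neg_distrib, pow_add,
    show z + (1 + (n : ℂ)) = z + 1 + n by ring]
  simp
  ring

theorem meromorphic_Gamma (z : ℂ) : MeromorphicAt Complex.Gamma z := by
  rw [show Complex.Gamma = (fun s => (Complex.Gamma s)⁻¹)⁻¹ from (inv_inv _).symm]
  exact (Complex.differentiable_one_div_Gamma.analyticAt z).meromorphicAt.inv

theorem analyticAt_kurepaIntegral_add {z : ℂ} {n : ℕ} (hz : 0 < (z + n).re) :
    AnalyticAt ℂ (fun w => kurepaIntegral (w + n)) z := by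
  have h : AnalyticAt ℂ kurepaIntegral (z + n) := by
    refine DifferentiableOn.analyticAt (s := {w | 0 < w.re})
      (fun w hw => (differentiableAt_kurepaIntegral hw).differentiableWithinAt)
      ((isOpen_lt continuous_const Complex.continuous_re).mem_nhds hz)
  exact h.comp_of_eq (analyticAt_id.add analyticAt_const) rfl

theorem meromorphicOn_kurepaA : MeromorphicOn kurepaA Set.univ := by
  intro z _
  obtain ⟨n, hn⟩ := exists_nat_add_re_pos z
  have : MeromorphicAt (kurepaStep n) z := by
    refine MeromorphicAt.add ?_ (MeromorphicAt.fun_sum fun k _ => ?_)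
    · exact (analyticAt_const.mul (analyticAt_kurepaIntegral_add hn)).meromorphicAt
    · refine (MeromorphicAt.const _ _).mul ?_
      exact (meromorphic_Gamma _).comp_analyticAt
        ((analyticAt_id.add analyticAt_const).add analyticAt_const)
  exact this.congr ((kurepaA_eventuallyEq hn).filter_mono nhdsWithin_le_nhds).symm

theorem analyticAt_Gamma {z : ℂ} (hz : ∀ m : ℕ, z ≠ -m) : AnalyticAt ℂ Complex.Gamma z := by
  have := (Complex.differentiable_one_div_Gamma.analyticAt z).inv
    (inv_ne_zero (Complex.Gamma_ne_zero hz))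
  simpa [Function.comp_def, Pi.inv_def] using this

theorem analyticOnNhd_kurepaA : AnalyticOnNhd ℂ kurepaA (Set.range (Int.cast : ℤ → ℂ))ᶜ := by
  intro z hz
  obtain ⟨n, hn⟩ := exists_nat_add_re_pos z
  have : AnalyticAt ℂ (kurepaStep n) z := by
    refine AnalyticAt.add (analyticAt_const.mul (analyticAt_kurepaIntegral_add hn))
      (Finset.analyticAt_fun_sum _ fun k _ => analyticAt_const.mul ?_)
    refine (analyticAt_Gamma fun m hm => hz ⟨-m - k - 2, ?_⟩).comp_of_eq
      ((analyticAt_id.add analyticAt_const).add analyticAt_const) rfl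
    push_cast
    linear_combination -hm
  exact this.congr (kurepaA_eventuallyEq hn).symm

end AlternatingKurepa

/-! ### The function `A₁`: convergence, functional equation, analyticity. -/

namespace AlternatingKurepa

open Filter Topology

theorem differentiable_inv_Gamma_sub (n : ℕ) :
    Differentiable ℂ fun z : ℂ => (Complex.Gamma (n - z))⁻¹ :=
  Complex.differentiable_one_div_Gamma.comp (differentiable_id.const_sub (n : ℂ))

/-- From `1/Γ(s) = s/Γ(s+1)`: as `|N + k - z| ≥ 2`, each step at least halves the bound. -/
theorem norm_inv_Gamma_sub_le {R M : ℝ} {N : ℕ} (hN : R + 2 ≤ N) {z : ℂ} (hz : ‖z‖ ≤ R)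
    (hM : ‖(Complex.Gamma (N - z))⁻¹‖ ≤ M) (k : ℕ) :
    ‖(Complex.Gamma ((N + k : ℕ) - z))⁻¹‖ ≤ M * (1 / 2) ^ k := by
  induction k with
  | zero => simpa using hM
  | succ k ih =>
    rw [Complex.one_div_Gamma_eq_self_mul_one_div_Gamma_add_one, norm_mul] at ih
    have h2 : 2 ≤ ‖((N + k : ℕ) : ℂ) - z‖ := by
      have h1 := norm_sub_norm_le ((N + k : ℕ) : ℂ) z
      rw [Complex.norm_natCast, Nat.cast_add] at h1
      have : (0 : ℝ) ≤ k := k.cast_nonneg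
      linarith
    have h3 : ((N + k : ℕ) : ℂ) - z + 1 = ((N + (k + 1) : ℕ) : ℂ) - z := by push_cast; ring
    rw [h3] at ih
    have h4 := mul_le_mul_of_nonneg_right h2
      (norm_nonneg (Complex.Gamma (((N + (k + 1) : ℕ) : ℂ) - z))⁻¹)
    rw [pow_succ]
    linarith

theorem exists_summable_bound (R : ℝ) : ∃ u : ℕ → ℝ, Summable u ∧
    ∀ n : ℕ, ∀ z ∈ Metric.ball (0 : ℂ) R, ‖(Complex.Gamma (n - z))⁻¹‖ ≤ u n := by
  have hbd : ∀ n : ℕ, ∃ M, ∀ z ∈ Metric.closedBall (0 : ℂ) R, ‖(Complex.Gamma (n - z))⁻¹‖ ≤ M :=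
    fun n => (isCompact_closedBall 0 R).exists_bound_of_continuousOn
      (differentiable_inv_Gamma_sub n).continuous.continuousOn
  choose M hM using hbd
  obtain ⟨N, hN⟩ := exists_nat_ge (R + 2)
  -- The first `N` terms are bounded by compactness, the tail geometrically.
  refine ⟨fun n => if n < N then M n else M N * (1 / 2) ^ (n - N), ?_, ?_⟩
  · rw [← summable_nat_add_iff N]
    simpa using (summable_geometric_of_lt_one (by norm_num) (by norm_num) :
      Summable fun n : ℕ => (1 / 2 : ℝ) ^ n).mul_left (M N)
  · intro n z hz
    have hz' := Metric.ball_subset_closedBall hz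
    simp only
    split_ifs with h
    · exact hM n z hz'
    · obtain ⟨k, rfl⟩ := Nat.exists_eq_add_of_le (not_lt.1 h)
      rw [Nat.add_sub_cancel_left]
      exact norm_inv_Gamma_sub_le hN (by simpa using hz') (hM N z hz') k

theorem summable_inv_Gamma_sub (z : ℂ) : Summable fun n : ℕ => (Complex.Gamma (n - z))⁻¹ := by
  obtain ⟨u, hu, h⟩ := exists_summable_bound (‖z‖ + 1)
  exact Summable.of_norm_bounded hu fun n => h n z (by simp)

/-- The entire function `∑ 1 / Γ(n - z)`. -/
noncomputable def invGammaSum (z : ℂ) : ℂ := ∑' n : ℕ, (Complex.Gamma (n - z))⁻¹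

theorem differentiable_invGammaSum : Differentiable ℂ invGammaSum := by
  intro z
  obtain ⟨u, hu, h⟩ := exists_summable_bound (‖z‖ + 1)
  exact (Complex.differentiableOn_tsum_of_summable_norm hu
    (fun n => (differentiable_inv_Gamma_sub n).differentiableOn) Metric.isOpen_ball
    h).differentiableAt
    (Metric.isOpen_ball.mem_nhds (by simp))

/-- The reflection formula. The factor in front does not depend on `n`, so `A₁` is `-π / sin(πz)`
times an entire function. -/
theorem neg_one_pow_mul_Gamma {z : ℂ} (hz : z ∉ Set.range (Int.cast : ℤ → ℂ)) (n : ℕ) :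
    (-1) ^ n * Complex.Gamma (z + 1 - n) =
      -(Real.pi / Complex.sin (Real.pi * z)) * (Complex.Gamma (n - z))⁻¹ := by
  have h := Complex.Gamma_mul_Gamma_one_sub (n - z)
  have hne : Complex.Gamma (n - z) ≠ 0 := by
    refine Complex.Gamma_ne_zero fun m hm => hz ⟨n + m, ?_⟩
    push_cast
    linear_combination hm
  have hc : Complex.cos (n * Real.pi) = (-1) ^ n := by
    exact_mod_cast congrArg Complex.ofReal (Real.cos_nat_mul_pi n)
  rw [show (Real.pi : ℂ) * (n - z) = n * Real.pi - Real.pi * z by ring,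
    Complex.sin_sub, Complex.sin_nat_mul_pi, hc, zero_mul, zero_sub,
    show 1 - ((n : ℂ) - z) = z + 1 - n by ring] at h
  have h2 : ((-1 : ℂ) ^ n) * (-1) ^ n = 1 := by rw [← mul_pow]; simp
  rw [eq_mul_inv_iff_mul_eq₀ hne, mul_assoc, mul_comm (Complex.Gamma (z + 1 - n)), h, div_neg,
    mul_neg, neg_inj, ← div_div, mul_comm ((-1 : ℂ) ^ n), div_mul_eq_mul_div, div_mul_eq_mul_div]
  congr 1
  rcases neg_one_pow_eq_or ℂ n with h | h <;> simp [h]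

theorem summable_kurepaA1 {z : ℂ} (hz : z ∉ Set.range (Int.cast : ℤ → ℂ)) :
    Summable fun n : ℕ => (-1 : ℂ) ^ n * Complex.Gamma (z + 1 - n) := by
  simp only [neg_one_pow_mul_Gamma hz]
  exact (summable_inv_Gamma_sub z).mul_left _

theorem kurepaA1_eq {z : ℂ} (hz : z ∉ Set.range (Int.cast : ℤ → ℂ)) :
    kurepaA1 z = -(Real.pi / Complex.sin (Real.pi * z)) * invGammaSum z := by
  simp only [kurepaA1, neg_one_pow_mul_Gamma hz]
  exact tsum_mul_left

/-- The term of index `n + 1` at `z + 1` is minus the term of index `n` at `z`; only the term of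
index `0` at `z + 1` remains. -/
theorem kurepaA1_add {z : ℂ} (hz : z ∉ Set.range (Int.cast : ℤ → ℂ)) :
    kurepaA1 z + kurepaA1 (z + 1) = Complex.Gamma (z + 2) := by
  have hz1 : z + 1 ∉ Set.range (Int.cast : ℤ → ℂ) := by
    rintro ⟨n, hn⟩
    refine hz ⟨n - 1, ?_⟩
    push_cast
    linear_combination hn
  have h : ∀ n : ℕ, (-1 : ℂ) ^ (n + 1) * Complex.Gamma (z + 1 + 1 - (n + 1 : ℕ)) =
      -((-1) ^ n * Complex.Gamma (z + 1 - n)) := by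
    intro n
    rw [pow_succ, show z + 1 + 1 - ((n + 1 : ℕ) : ℂ) = z + 1 - n by push_cast; ring]
    ring
  rw [kurepaA1, kurepaA1, (summable_kurepaA1 hz1).tsum_eq_zero_add, tsum_congr h, tsum_neg]
  simp only [pow_zero, one_mul, Nat.cast_zero, sub_zero]
  rw [show z + 1 + 1 = z + 2 by ring]
  ring

theorem eventually_notMem_range_intCast (z : ℂ) :
    ∀ᶠ w in 𝓝[≠] z, w ∉ Set.range (Int.cast : ℤ → ℂ) := by
  obtain ⟨M, hM⟩ := exists_nat_ge (‖z‖ + 1)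
  have hfin : ((Int.cast : ℤ → ℂ) '' Set.Icc (-M : ℤ) M).Finite := (Set.finite_Icc _ _).image _
  filter_upwards [nhdsNE_le_cofinite z hfin.compl_mem_cofinite,
    mem_nhdsWithin_of_mem_nhds (Metric.ball_mem_nhds z one_pos)] with w hw hwz
  rintro ⟨n, rfl⟩
  refine hw ⟨n, ?_, rfl⟩
  rw [Metric.mem_ball, dist_eq_norm] at hwz
  have h1 := norm_sub_norm_le (n : ℂ) z
  rw [Complex.norm_intCast] at h1
  rw [Set.mem_Icc, ← abs_le]
  have h2 : |(n : ℝ)| ≤ M := by linarith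
  exact_mod_cast h2

theorem analyticAt_sin_pi_mul (z : ℂ) : AnalyticAt ℂ (fun z => Complex.sin (Real.pi * z)) z :=
  (Complex.differentiable_sin.comp (differentiable_id.const_mul (Real.pi : ℂ))).analyticAt z

theorem meromorphicOn_kurepaA1 : MeromorphicOn kurepaA1 Set.univ := by
  intro z _
  have h : MeromorphicAt
      (fun z => -(Real.pi / Complex.sin (Real.pi * z)) * invGammaSum z) z :=
    (((MeromorphicAt.const _ _).div (analyticAt_sin_pi_mul z).meromorphicAt).neg).mul
      (differentiable_invGammaSum.analyticAt z).meromorphicAt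
  refine h.congr ?_
  filter_upwards [eventually_notMem_range_intCast z] with w hw
  exact (kurepaA1_eq hw).symm

theorem isOpen_compl_range_intCast : IsOpen (Set.range (Int.cast : ℤ → ℂ))ᶜ := by
  rw [isOpen_iff_mem_nhds]
  intro z hz
  have h := eventually_notMem_range_intCast z
  rw [eventually_nhdsWithin_iff] at h
  filter_upwards [h] with w hw
  by_cases hwz : w = z
  · rwa [hwz]
  · exact hw hwz

theorem analyticOnNhd_kurepaA1 : AnalyticOnNhd ℂ kurepaA1 (Set.range (Int.cast : ℤ → ℂ))ᶜ := by
  intro z hz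
  have hsin : Complex.sin (Real.pi * z) ≠ 0 := by
    rw [Complex.sin_ne_zero_iff]
    intro k hk
    refine hz ⟨k, ?_⟩
    rw [mul_comm] at hk
    exact (mul_right_cancel₀ (Complex.ofReal_ne_zero.2 Real.pi_ne_zero) hk).symm
  have h : AnalyticAt ℂ
      (fun z => -(Real.pi / Complex.sin (Real.pi * z)) * invGammaSum z) z :=
    ((analyticAt_const.div (analyticAt_sin_pi_mul z) hsin).neg).mul
      (differentiable_invGammaSum.analyticAt z)
  refine h.congr ?_
  filter_upwards [isOpen_compl_range_intCast.mem_nhds hz] with w hw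
  exact (kurepaA1_eq hw).symm

end AlternatingKurepa

/-- The alternating Kurepa function `A` and the function `A₁` are meromorphic on `ℂ`, and on no
domain `D ⊆ ℂ` does either of them satisfy an algebraic differential equation over `ℂ(z)`. -/
theorem mainTheorem3 :
    (MeromorphicOn AlternatingKurepa.kurepaA Set.univ ∧
      MeromorphicOn AlternatingKurepa.kurepaA1 Set.univ) ∧
    ∀ D : Set ℂ, IsOpen D → IsConnected D →
      ¬ AlternatingKurepa.SatisfiesADE D AlternatingKurepa.kurepaA ∧
      ¬ AlternatingKurepa.SatisfiesADE D AlternatingKurepa.kurepaA1 := by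
  refine ⟨⟨AlternatingKurepa.meromorphicOn_kurepaA, AlternatingKurepa.meromorphicOn_kurepaA1⟩,
    fun D hD hDc => ⟨?_, ?_⟩⟩
  · exact AlternatingKurepa.not_satisfiesADE hD hDc.nonempty
      AlternatingKurepa.analyticOnNhd_kurepaA fun z _ => AlternatingKurepa.kurepaA_add z
  · exact AlternatingKurepa.not_satisfiesADE hD hDc.nonempty
      AlternatingKurepa.analyticOnNhd_kurepaA1 fun z hz =>
        AlternatingKurepa.kurepaA1_add (AlternatingKurepa.upper_subset_compl_range_intCast hz)
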